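/- Let $k$ be a field. All $k$-schemes below are separated and of finite type over $k$. Fix a class $\mathcal Q$ of $k$-schemes that is stable under products over $k$ (for example all $k$-schemes, or the quasi-projective ones). **The category $\mathbf{Sm}_{\log}(k)$.** Let $X$ be a smooth $k$-scheme. A reduced closed subscheme $\partial X\subset X$ is a *strict normal crossing divisor* if for every non-empty finite set $A$ of irreducible components of $\partial X$ the scheme-theoretic intersection $\bigcap_{D\in A}D$ is smooth over $k$ and of pure codimension $|A|$ in $X$ (the empty scheme being of every pure codimension; $\partial X=\emptyset$ is allowed). Objects of $\mathbf{Sm}_{\log}(k)$ are pairs $(X,\partial X)$ with $X$ a smooth $k$-scheme in $\mathcal Q$ and $\partial X$ a strict normal crossing divisor on $X$. A morphism $(X,\partial X)\to(Y,\partial Y)$ is a $k$-morphism $f\colon X\to Y$ such that $f(X\setminus|\partial X|)\subseteq Y\setminus|\partial Y|$ and such that for every irreducible component $\partial Y_i$ of $\partial Y$ the reduced inverse image $f^{-1}(\partial Y_i)_{\rm red}$ is a strict normal crossing divisor on $X$. **The category $\mathbf{BSm}_{\log}(k)$.** An *admissible blow-up* is a morphism $\pi\colon(X',\partial X')\to(X,\partial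 X)$ of $\mathbf{Sm}_{\log}(k)$ whose underlying morphism $X'\to X$ is projective (it factors as a closed immersion into some $\mathbb P^n_X$ followed by the projection to $X$) and birational, restricts to an isomorphism $X'\setminus|\partial X'|\cong X\setminus|\partial X|$, and satisfies $|\partial X'|=|\pi^{-1}(\partial X)|$. Let $v\colon\mathbf{Sm}_{\log}(k)\to\mathbf{BSm}_{\log}(k)$ be the localization of $\mathbf{Sm}_{\log}(k)$ at the class of admissible blow-ups. **Statement.** For all $(X,\partial X)$ and $(Y,\partial Y)$ in $\mathbf{Sm}_{\log}(k)$, the reduced closed subscheme $\partial X\times Y+X\times\partial Y$ of $X\times_kY$ with support $|\partial X|\times Y\,\cup\,X\times|\partial Y|$ is a strict normal crossing divisor, so that $$(X,\partial X)\otimes(Y,\partial Y)=(X\times_k Y,\ \partial X\times Y+X\times\partial Y)$$ is an object of $\mathbf{Sm}_{\log}(k)$; the two projections from it to $(X,\partial X)$ and $(Y,\partial Y)$ are morphisms of $\mathbf{Sm}_{\log}(k)$; and their images under $v$ exhibit $(X,\partial X)\otimes(Y,\partial Y)$ as the product of $(X,\partial X)$ and $(Y,\partial Y)$ in the category $\mathbf{BSm}_{\log}(k)$.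 -/

import Mathlib

open CategoryTheory CategoryTheory.Limits AlgebraicGeometry TopologicalSpace

universe u

namespace LogPair

section Topology

variable {X Y : Type*} [TopologicalSpace X] [TopologicalSpace Y]

/-- The irreducible components of a closed subset `D` of a space `X`, as irreducible closed
subsets of `X`: the maximal irreducible closed subsets of `X` contained in `D`. -/
def components (D : Closeds X) : Set (IrreducibleCloseds X) :=
  {T | Maximal (fun S : IrreducibleCloseds X => (S : Set X) ⊆ D) T}

/-- A closed subset is of pure codimension `n` if all its irreducible components have
codimension `n` (the supremum of the lengths of chains of irreducible closed subsets of `X`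
going up from the given one). It holds for the empty subset. -/
def IsOfPureCodim (D : Closeds X) (n : ℕ) : Prop :=
  ∀ T ∈ components D, Order.coheight T = n

/-- The preimage of a closed subset. -/
def preim (f : X → Y) (hf : Continuous f) (D : Closeds Y) : Closeds X :=
  ⟨f ⁻¹' D, D.isClosed.preimage hf⟩

theorem exists_le_component (D : Closeds X) (S : IrreducibleCloseds X) (hS : (S : Set X) ⊆ D) :
    ∃ T ∈ components D, S ≤ T := by
  have hpre : IsPreirreducible ((↑) ⁻¹' (S : Set X) : Set D) := by
    have h := S.isIrreducible.2
    intro U V hU hV hSU hSV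
    obtain ⟨U', hU', rfl⟩ := isOpen_induced_iff.1 hU
    obtain ⟨V', hV', rfl⟩ := isOpen_induced_iff.1 hV
    obtain ⟨x, hx, hxU⟩ := hSU
    obtain ⟨y, hy, hyV⟩ := hSV
    obtain ⟨z, hz, hzU, hzV⟩ := h U' V' hU' hV' ⟨x, hx, hxU⟩ ⟨y, hy, hyV⟩
    exact ⟨⟨z, hS hz⟩, hz, hzU, hzV⟩
  obtain ⟨t, ht, hSt, hmax⟩ := exists_preirreducible _ hpre
  obtain ⟨s, hs⟩ := S.isIrreducible.1
  have htirr : IsIrreducible ((↑) '' t : Set X) :=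
    ⟨⟨s, ⟨s, hS hs⟩, hSt hs, rfl⟩, ht.image _ continuous_subtype_val.continuousOn⟩
  let T : IrreducibleCloseds X := ⟨closure ((↑) '' t), htirr.closure, isClosed_closure⟩
  have hTD : (T : Set X) ⊆ D :=
    closure_minimal (by rintro _ ⟨x, _, rfl⟩; exact x.2) D.isClosed
  have hle : S ≤ T := fun x hx => subset_closure ⟨⟨x, hS hx⟩, hSt hx, rfl⟩
  refine ⟨T, ⟨hTD, fun R hR hTR => ?_⟩, hle⟩
  have hRpre : IsPreirreducible ((↑) ⁻¹' (R : Set X) : Set D) := by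
    have h := R.isIrreducible.2
    intro U V hU hV hSU hSV
    obtain ⟨U', hU', rfl⟩ := isOpen_induced_iff.1 hU
    obtain ⟨V', hV', rfl⟩ := isOpen_induced_iff.1 hV
    obtain ⟨x, hx, hxU⟩ := hSU
    obtain ⟨y, hy, hyV⟩ := hSV
    obtain ⟨z, hz, hzU, hzV⟩ := h U' V' hU' hV' ⟨x, hx, hxU⟩ ⟨y, hy, hyV⟩
    exact ⟨⟨z, hR hz⟩, hz, hzU, hzV⟩
  have := hmax _ hRpre (fun x hx => hTR (subset_closure ⟨x, hx, rfl⟩))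
  intro x hx
  exact subset_closure ⟨⟨x, hR hx⟩, this ▸ hx, rfl⟩

theorem components_subset {D E : Closeds X} (hD : IsOfPureCodim D 1) (hE : IsOfPureCodim E 1)
    (hED : (E : Set X) ⊆ D) : components E ⊆ components D := by
  intro T hT
  obtain ⟨T', hT', hle⟩ := exists_le_component D T (hT.1.trans hED)
  rcases hle.eq_or_lt with h | h
  · exact h ▸ hT'
  · have h1 := Order.coheight_add_one_le h
    rw [hD T' hT', hE T hT] at h1
    exact absurd h1 (by decide)

end Topology

section Schemes

attribute [local instance] MvPolynomial.gradedAlgebra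

/-- Projective space `ℙⁿ` over a scheme `S`, the base change to `S` of `Proj ℤ[x₀, …, xₙ]`. -/
noncomputable def ProjectiveSpace (n : ℕ) (S : Scheme.{u}) : Scheme.{u} :=
  pullback (terminal.from S)
    (terminal.from (Proj (MvPolynomial.homogeneousSubmodule (Fin (n + 1)) (ULift.{u} ℤ))))

/-- The structure morphism `ℙⁿ_S ⟶ S`. -/
noncomputable def ProjectiveSpace.toBase (n : ℕ) (S : Scheme.{u}) : ProjectiveSpace n S ⟶ S :=
  pullback.fst _ _

/-- `f : X ⟶ Y` is projective: it factors as a closed immersion into some `ℙⁿ_Y` followed by the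
structure morphism `ℙⁿ_Y ⟶ Y`. -/
def IsProjectiveMorphism {X Y : Scheme.{u}} (f : X ⟶ Y) : Prop :=
  ∃ (n : ℕ) (i : X ⟶ ProjectiveSpace n Y),
    IsClosedImmersion i ∧ i ≫ ProjectiveSpace.toBase n Y = f

/-- `f : X ⟶ Y` is birational: it is an isomorphism over a dense open subset of `Y` whose
preimage is dense in `X`. -/
def IsBirationalMorphism {X Y : Scheme.{u}} (f : X ⟶ Y) : Prop :=
  ∃ U : Y.Opens, Dense (U : Set Y) ∧ Dense ((f ⁻¹ᵁ U : X.Opens) : Set X) ∧ IsIso (f ∣_ U)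

/-- The ideal sheaf of the scheme-theoretic intersection of finitely many irreducible closed
subsets of `X`, each with its reduced subscheme structure. -/
noncomputable def interIdeal {X : Scheme.{u}} (A : Finset (IrreducibleCloseds X)) :
    X.IdealSheafData :=
  ⨆ T ∈ A, Scheme.IdealSheafData.vanishingIdeal ⟨(T : Set X), T.isClosed⟩

/-- A reduced closed subscheme of `X`, given by its underlying closed subset `D`, is a strict
normal crossing divisor relative to `s : X ⟶ S` if for every non-empty finite set `A` of
irreducible components of `D`, the scheme-theoretic intersection of the members of `A` is smooth
over `S` and of pure codimension `|A|` in `X`. -/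
def IsSNC {X S : Scheme.{u}} (s : X ⟶ S) (D : Closeds X) : Prop :=
  ∀ A : Finset (IrreducibleCloseds X), A.Nonempty → (∀ T ∈ A, T ∈ components D) →
    Smooth ((interIdeal A).subschemeι ≫ s) ∧ IsOfPureCodim (interIdeal A).support A.card

theorem IsSNC.mono {X S : Scheme.{u}} {s : X ⟶ S} {D E : Closeds X} (hD : IsSNC s D)
    (h : components E ⊆ components D) : IsSNC s E :=
  fun A hA hAE => hD A hA fun T hT => h (hAE T hT)

theorem components_coe {X : Type*} [TopologicalSpace X] (T : IrreducibleCloseds X) :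
    components (⟨(T : Set X), T.isClosed⟩ : Closeds X) = {T} := by
  ext R
  constructor
  · intro hR
    exact le_antisymm hR.1 (hR.2 (y := T) (fun _ h => h) hR.1)
  · rintro rfl
    exact ⟨fun _ h => h, fun _ h _ => h⟩

theorem IsSNC.isOfPureCodim {X S : Scheme.{u}} {s : X ⟶ S} {D : Closeds X} (hD : IsSNC s D) :
    IsOfPureCodim D 1 := by
  intro T hT
  have h := (hD {T} (Finset.singleton_nonempty T) (by simpa using hT)).2
  have e : (interIdeal {T}).support = (⟨(T : Set X), T.isClosed⟩ : Closeds X) := by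
    ext x
    simp [interIdeal]
  rw [e, Finset.card_singleton] at h
  exact h T (by rw [components_coe]; rfl)

end Schemes

end LogPair

open LogPair

/-- The objects of `Sm_log(k)`, with underlying schemes in a class `Q` of `k`-schemes: pairs
`(X, ∂X)` of a smooth separated `k`-scheme `X` of finite type belonging to `Q` and a (possibly
empty) strict normal crossing divisor `∂X` on `X`. For `Q = ⊤` these are all pairs; if `Q` is
the class of quasi-projective `k`-schemes, these are the pairs with `X` quasi-projective. -/
structure SmLog (k : Type u) [Field k] (Q : ObjectProperty (Over (Spec (.of k)))) where
  X : Over (Spec (.of k))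
  mem : Q X
  smooth : Smooth X.hom
  separated : IsSeparated X.hom
  quasiCompact : QuasiCompact X.hom
  bdry : Closeds X.left
  snc : IsSNC X.hom bdry

namespace SmLog

variable {k : Type u} [Field k] {Q : ObjectProperty (Over (Spec (.of k)))}

/-- A `k`-morphism `f : X ⟶ Y` is admissible for the pairs `(X, ∂X)` and `(Y, ∂Y)` if the reduced
inverse image of every irreducible component of `∂Y` is a strict normal crossing divisor on `X`
and `f` maps `X ∖ |∂X|` into `Y ∖ |∂Y|`. -/
structure IsAdmissible (M N : SmLog k Q) (f : M.X ⟶ N.X) : Prop where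
  snc : ∀ T ∈ components N.bdry,
    IsSNC M.X.hom (preim f.left f.left.continuous ⟨(T : Set N.X.left), T.isClosed⟩)
  compl : ∀ x : M.X.left, x ∉ M.bdry → f.left x ∉ N.bdry

theorem IsAdmissible.id (M : SmLog k Q) : IsAdmissible M M (𝟙 M.X) where
  snc T hT := by
    have e : preim (𝟙 M.X : M.X ⟶ M.X).left (𝟙 M.X : M.X ⟶ M.X).left.continuous
        ⟨(T : Set M.X.left), T.isClosed⟩ = ⟨(T : Set M.X.left), T.isClosed⟩ := by
      ext x
      simp [preim]
    rw [e]
    refine M.snc.mono ?_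
    rw [components_coe]
    simpa using hT
  compl x hx := by simpa using hx

theorem IsAdmissible.comp {M N P : SmLog k Q} {f : M.X ⟶ N.X} {g : N.X ⟶ P.X}
    (hf : IsAdmissible M N f) (hg : IsAdmissible N P g) : IsAdmissible M P (f ≫ g) where
  snc T hT := by
    refine M.snc.mono fun C hC => ?_
    have hCsub : ∀ x ∈ C, g.left (f.left x) ∈ T := fun x hx => by
      simpa [preim] using hC.1 hx
    let D : Closeds N.X.left := preim g.left g.left.continuous ⟨(T : Set P.X.left), T.isClosed⟩
    have hD : (D : Set N.X.left) ⊆ N.bdry := fun y hy => by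
      by_contra h
      exact hg.compl y h (hT.1 hy)
    have hcD : components D ⊆ components N.bdry :=
      components_subset N.snc.isOfPureCodim (hg.snc T hT).isOfPureCodim hD
    obtain ⟨T', hT', hle⟩ := exists_le_component D
      ⟨closure (f.left '' (C : Set M.X.left)),
        (C.isIrreducible.image _ f.left.continuous.continuousOn).closure, isClosed_closure⟩
      (closure_minimal (by rintro _ ⟨x, hx, rfl⟩; exact hCsub x hx) D.isClosed)
    have hS := hf.snc T' (hcD hT')
    refine components_subset M.snc.isOfPureCodim hS.isOfPureCodim ?_ ⟨?_, ?_⟩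
    · intro x hx
      by_contra h
      exact hf.compl x h ((hcD hT').1 hx)
    · intro x hx
      exact hle (subset_closure ⟨x, hx, rfl⟩)
    · intro R hR hCR
      refine hC.2 (fun x hx => ?_) hCR
      have : g.left (f.left x) ∈ T := hT'.1 (hR hx)
      simpa [preim] using this
  compl x hx := by simpa using hg.compl _ (hf.compl x hx)

/-- The category `Sm_log(k)`. -/
noncomputable instance : Category (SmLog k Q) where
  Hom M N := {f : M.X ⟶ N.X // IsAdmissible M N f}
  id M := ⟨𝟙 M.X, .id M⟩
  comp f g := ⟨f.1 ≫ g.1, f.2.comp g.2⟩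
  id_comp f := Subtype.ext (Category.id_comp f.1)
  comp_id f := Subtype.ext (Category.comp_id f.1)
  assoc f g h := Subtype.ext (Category.assoc f.1 g.1 h.1)

/-- The class `S_b` of admissible blow-ups: the morphisms `π : (X', ∂X') ⟶ (X, ∂X)` of
`Sm_log(k)` whose underlying morphism is projective and birational, restricts to an isomorphism
`X' ∖ |∂X'| ≅ X ∖ |∂X|`, and satisfies `|∂X'| = π⁻¹(|∂X|)`. (By the last condition,
`X' ∖ |∂X'|` is the preimage of `X ∖ |∂X|`.) -/
def admissibleBlowups (k : Type u) [Field k] (Q : ObjectProperty (Over (Spec (.of k)))) :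
    MorphismProperty (SmLog k Q) :=
  fun M N π => IsProjectiveMorphism π.1.left ∧ IsBirationalMorphism π.1.left ∧
    IsIso (π.1.left ∣_ N.bdry.compl) ∧
    (M.bdry : Set M.X.left) = π.1.left ⁻¹' (N.bdry : Set N.X.left)

/-- The fibre product `X ×_k Y` of two `k`-schemes. -/
noncomputable abbrev prodScheme (X Y : Over (Spec (.of k))) : Over (Spec (.of k)) :=
  Over.mk (pullback.fst X.hom Y.hom ≫ X.hom)

/-- The projection `X ×_k Y ⟶ X`, over `k`. -/
noncomputable abbrev prodFst (X Y : Over (Spec (.of k))) : prodScheme X Y ⟶ X :=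
  Over.homMk (pullback.fst X.hom Y.hom)

/-- The projection `X ×_k Y ⟶ Y`, over `k`. -/
noncomputable abbrev prodSnd (X Y : Over (Spec (.of k))) : prodScheme X Y ⟶ Y :=
  Over.homMk (pullback.snd X.hom Y.hom) (by simp [pullback.condition])

/-- The (support of the) divisor `∂X × Y + X × ∂Y` on `X ×_k Y`. -/
noncomputable def prodBdry (M N : SmLog k Q) : Closeds (prodScheme M.X N.X).left :=
  preim (prodFst M.X N.X).left (prodFst M.X N.X).left.continuous M.bdry ⊔
    preim (prodSnd M.X N.X).left (prodSnd M.X N.X).left.continuous N.bdry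

/-- The pair `(X × Y, ∂X × Y + X × ∂Y)`, once its boundary is known to be a strict normal crossing
divisor and `X × Y` is known to belong to `Q`. -/
noncomputable def tensor (M N : SmLog k Q) (hmem : Q (prodScheme M.X N.X))
    (hsnc : IsSNC (prodScheme M.X N.X).hom (prodBdry M N)) : SmLog k Q :=
  have := M.smooth
  have := N.smooth
  have := M.separated
  have := N.separated
  have := M.quasiCompact
  have := N.quasiCompact
  { X := prodScheme M.X N.X
    mem := hmem
    smooth := inferInstanceAs (Smooth (pullback.fst M.X.hom N.X.hom ≫ M.X.hom))
    separated := inferInstanceAs (IsSeparated (pullback.fst M.X.hom N.X.hom ≫ M.X.hom))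
    quasiCompact := inferInstanceAs (QuasiCompact (pullback.fst M.X.hom N.X.hom ≫ M.X.hom))
    bdry := prodBdry M N
    snc := hsnc }

end SmLog

/-- The category `BSm_log(k) = Sm_log(k)[S_b⁻¹]`. -/
abbrev BSmLog (k : Type u) [Field k] (Q : ObjectProperty (Over (Spec (.of k)))) :=
  (SmLog.admissibleBlowups k Q).Localization

/-- The localization functor `v : Sm_log(k) ⥤ BSm_log(k)`. -/
noncomputable abbrev BSmLog.v (k : Type u) [Field k] (Q : ObjectProperty (Over (Spec (.of k)))) :
    SmLog k Q ⥤ BSmLog k Q :=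
  (SmLog.admissibleBlowups k Q).Q

/-! The pair `tensor M N` is already the product of `M` and `N` in `Sm_log(k)` (`isLimitProd`), so
it suffices that `v` preserves binary products. A localization does so as soon as it inverts `f × Z`
for every localized `f` and every object `Z` (`preservesBinaryProducts_Q`); no calculus of fractions
is needed. Here `π × N` is even an admissible blow-up (`admissibleBlowups_prodRight`), being the
base change of `π` along the projection `M × N ⟶ M`, which is smooth and hence open.

The geometric difficulty is that the inverse image in `X × Y` of a component of `∂X` or `∂Y` may be
reducible. It is smooth over `k`, though, so its components are pairwise disjoint
(`disjointComponents_prodPreim`). Hence an intersection of components of the product divisor is open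
in an intersection of full inverse images, which is the product of an intersection in `X` and one in
`Y`: smoothness follows by base change and codimensions add (`isSNC_prodSum`). The same disjointness
makes induced maps into the product admissible (`isAdmissible_lift`).

Two algebraic facts carry this. Local rings of smooth `k`-schemes are domains, because smooth
algebras are locally étale over polynomial rings and integral closure commutes with smooth base
change. The height of a minimal prime over `I ⊗ A' + A ⊗ I'` is the sum of the heights of its
contractions, by going down for flat maps. -/

section CommutativeAlgebra

open TensorProduct

/-! ### Local rings of étale and smooth algebras -/

theorem Algebra.Etale.exists_mul_mul_eq_self {K A : Type u} [Field K] [CommRing A] [Algebra K A]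
    [Algebra.Etale K A] (x : A) : ∃ z, x * x * z = x := by
  obtain ⟨I, _, F, _, _, e, -⟩ := (Algebra.Etale.iff_exists_algEquiv_prod K A).1 inferInstance
  -- The algebra is a finite product of fields; `0⁻¹ = 0` covers the factors where `x` vanishes.
  refine ⟨e.symm fun i => (e x i)⁻¹, e.injective ?_⟩
  ext i
  simp

/-- An étale algebra over an integrally closed domain is locally a domain, in an elementary form. -/
theorem Algebra.Etale.exists_mul_eq_zero {A B : Type u} [CommRing A] [IsDomain A]
    [IsIntegrallyClosed A] [CommRing B] [Algebra A B] [Algebra.Etale A B] {x y : B}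
    (h : x * y = 0) : ∃ e : B, (1 - e) * x = 0 ∧ e * y = 0 := by
  let K := FractionRing A
  let i : B →ₐ[B] B ⊗[A] K := Algebra.TensorProduct.includeLeft
  have hi : Function.Injective i :=
    Algebra.TensorProduct.includeLeft_injective (IsFractionRing.injective A K)
  obtain ⟨z, hz⟩ := Algebra.Etale.exists_mul_mul_eq_self (K := K)
    (Algebra.TensorProduct.comm A B K (i x))
  obtain ⟨z, rfl⟩ := (Algebra.TensorProduct.comm A B K).surjective z
  rw [← map_mul, ← map_mul] at hz
  replace hz := (Algebra.TensorProduct.comm A B K).injective hz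
  -- `i x * z` is idempotent, hence integral over `B`. As `A` is integrally closed in `K` and `B` is
  -- smooth over `A`, it must come from `B`.
  have hint : IsIntegral B (i x * z) := by
    refine ⟨Polynomial.X ^ 2 - Polynomial.X, by monicity!, ?_⟩
    simp only [Polynomial.eval₂_sub, Polynomial.eval₂_X_pow, Polynomial.eval₂_X]
    linear_combination z * hz
  obtain ⟨w, hw⟩ := (TensorProduct.toIntegralClosure_bijective_of_smooth
    (R := A) (S := B) (B := K)).2 ⟨_, hint⟩
  have hb : ∃ b : B, w = b ⊗ₜ 1 := by
    clear hw
    induction w with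
    | zero => exact ⟨0, by simp⟩
    | add u v hu hv =>
      obtain ⟨b, rfl⟩ := hu
      obtain ⟨c, rfl⟩ := hv
      exact ⟨b + c, (add_tmul _ _ _).symm⟩
    | tmul b c =>
      obtain ⟨a, ha⟩ := IsIntegrallyClosed.isIntegral_iff.1 c.2
      refine ⟨a • b, ?_⟩
      have : c = a • 1 := Subtype.ext (by simp [← ha, Algebra.smul_def])
      rw [this, tmul_smul, smul_tmul']
  obtain ⟨b, rfl⟩ := hb
  have hib : i b = i x * z := by
    have h := congrArg Subtype.val hw
    simp only [TensorProduct.toIntegralClosure, AlgHom.coe_codRestrict] at h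
    exact .trans rfl h
  refine ⟨b, hi ?_, hi ?_⟩
  · rw [map_mul, map_sub, hib, map_one, map_zero]
    linear_combination -hz
  · rw [map_mul, hib, map_zero, mul_right_comm, ← map_mul, h, map_zero, zero_mul]

/-- If `x * y = 0`, some `e` satisfies `(1 - e) * x = 0` and `e * y = 0` up to denominators. The
prime `q` cannot contain both `e` and `1 - e`, so `x` or `y` dies in the localization. -/
theorem Algebra.Etale.isDomain_of_isLocalization_atPrime {A B C : Type u} [CommRing A] [IsDomain A]
    [IsIntegrallyClosed A] [CommRing B] [Algebra A B] [Algebra.Etale A B] [CommRing C]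
    [Algebra B C] (q : Ideal B) [q.IsPrime] [IsLocalization.AtPrime C q] : IsDomain C := by
  have := IsLocalization.AtPrime.isLocalRing C q
  have : NoZeroDivisors C := by
    refine ⟨fun {x y} hxy => ?_⟩
    obtain ⟨x, s, rfl⟩ := IsLocalization.exists_mk'_eq q.primeCompl x
    obtain ⟨y, t, rfl⟩ := IsLocalization.exists_mk'_eq q.primeCompl y
    rw [← IsLocalization.mk'_mul, IsLocalization.mk'_eq_zero_iff] at hxy
    obtain ⟨m, hm⟩ := hxy
    obtain ⟨e, hx, hy⟩ := Algebra.Etale.exists_mul_eq_zero (A := A) (x := m * x) (y := y)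
      (by rw [← hm]; ring)
    rw [IsLocalization.mk'_eq_zero_iff, IsLocalization.mk'_eq_zero_iff]
    by_cases he : e ∈ q
    · refine .inl ⟨⟨(1 - e) * m, q.primeCompl.mul_mem (fun h => ?_) m.2⟩, by simp [← hx]; ring⟩
      exact ‹q.IsPrime›.ne_top ((Ideal.eq_top_iff_one _).2 (by simpa using q.add_mem h he))
    · exact .inr ⟨⟨e, he⟩, hy⟩
  exact NoZeroDivisors.to_isDomain C

/-- Near `q` the algebra is étale over a polynomial ring, which is an integrally closed domain. -/
theorem Algebra.Smooth.isDomain_localization {k B : Type u} [Field k] [CommRing B]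
    [Algebra k B] [Algebra.Smooth k B] (q : Ideal B) [q.IsPrime] :
    IsDomain (Localization.AtPrime q) := by
  obtain ⟨f, hf, n, _, _, _⟩ :=
    Algebra.IsSmoothAt.exists_isStandardEtale_mvPolynomial (R := k) (p := q)
  obtain ⟨q', hq', rfl⟩ : ∃ q' : Ideal (Localization.Away f), q'.IsPrime ∧
      q'.comap (algebraMap B (Localization.Away f)) = q := by
    have hdisj : Disjoint (Submonoid.powers f : Set B) (q : Set B) := by
      rw [Set.disjoint_left]
      rintro _ ⟨m, rfl⟩ h
      exact hf (‹q.IsPrime›.mem_of_pow_mem m h)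
    exact ⟨_, IsLocalization.isPrime_of_isPrime_disjoint (.powers f) _ q ‹_› hdisj,
      IsLocalization.under_map_of_isPrime_disjoint (.powers f) _ ‹_› hdisj⟩
  have := Algebra.Etale.isDomain_of_isLocalization_atPrime (A := MvPolynomial (Fin n) k)
    (C := Localization.AtPrime q') q'
  have := IsLocalization.isLocalization_isLocalization_atPrime_isLocalization (.powers f)
    (Localization.AtPrime q') q'
  exact (IsLocalization.algEquiv (q'.comap (algebraMap B (Localization.Away f))).primeCompl
    (Localization.AtPrime (q'.comap (algebraMap B (Localization.Away f))))
    (Localization.AtPrime q')).toMulEquiv.isDomain _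

/-! ### Heights of minimal primes under flat maps and in tensor products -/

/-- Going down lifts a smaller prime over `I` to a prime below `q`, which still contains `I B` and
so equals `q`. -/
theorem Ideal.under_mem_minimalPrimes_of_flat {A B : Type u} [CommRing A] [CommRing B] [Algebra A B]
    [Module.Flat A B] {I : Ideal A} {q : Ideal B}
    (hq : q ∈ (I.map (algebraMap A B)).minimalPrimes) : q.under A ∈ I.minimalPrimes := by
  have := hq.1.1
  refine ⟨⟨inferInstance, Ideal.map_le_iff_le_comap.1 hq.1.2⟩, fun p hp hpq => ?_⟩
  have := hp.1
  obtain ⟨q', hle, hq', hover⟩ := Ideal.exists_ideal_le_liesOver_of_le (p := p) (q := q.under A) q hpq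
  have := hq.2 ⟨hq', Ideal.map_le_iff_le_comap.2 (hp.2.trans hover.over.le)⟩ hle
  exact (Ideal.comap_mono this).trans hover.over.ge

theorem Ideal.map_mk_mem_minimalPrimes {B : Type u} [CommRing B] {I J q : Ideal B}
    (hq : q ∈ (I ⊔ J).minimalPrimes) :
    q.map (Ideal.Quotient.mk J) ∈ (I.map (Ideal.Quotient.mk J)).minimalPrimes := by
  rw [Ideal.minimalPrimes_map_of_surjective Ideal.Quotient.mk_surjective, Ideal.mk_ker]
  exact ⟨q, hq, rfl⟩

/-- In the height formula for going down, the fibre term vanishes because `q` is minimal over the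
extension of its own contraction. -/
theorem Ideal.height_eq_of_mem_minimalPrimes_of_flat {A B : Type u} [CommRing A] [CommRing B]
    [Algebra A B] [Module.Flat A B] [IsNoetherianRing A] [IsNoetherianRing B] {I : Ideal A}
    {q : Ideal B} (hq : q ∈ (I.map (algebraMap A B)).minimalPrimes) :
    q.height = (q.under A).height := by
  have := hq.1.1
  rw [Ideal.height_eq_height_add_of_liesOver_of_hasGoingDown (q.under A) q]
  have hmin : q ∈ (⊥ ⊔ (q.under A).map (algebraMap A B)).minimalPrimes := by
    rw [bot_sup_eq]
    exact ⟨⟨‹_›, Ideal.map_comap_le⟩, fun p hp hpq => hq.2 ⟨hp.1, (Ideal.map_mono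
      (Ideal.map_le_iff_le_comap.1 hq.1.2)).trans hp.2⟩ hpq⟩
  have h := Ideal.map_mk_mem_minimalPrimes hmin
  rw [Ideal.map_bot] at h
  have := h.1.1
  rw [Ideal.height_eq_zero_iff.2 h, add_zero]

section TensorProduct

variable {k A A' : Type u} [Field k] [CommRing A] [CommRing A'] [Algebra k A] [Algebra k A']
  (I : Ideal A) (I' : Ideal A') (q : Ideal (A ⊗[k] A'))

/-- The quotient is `A ⊗[k] (A' ⧸ I')`, the base change to `A` of a `k`-vector space. -/
theorem flat_quotient_map_includeRight :
    Module.Flat A ((A ⊗[k] A') ⧸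
      I'.map (Algebra.TensorProduct.includeRight : A' →ₐ[k] A ⊗[k] A').toRingHom) :=
  .of_linearEquiv (Algebra.TensorProduct.tensorQuotientEquiv (R := k) A A' A I').symm.toLinearEquiv

theorem comap_map_mk_of_le {J : Ideal (A ⊗[k] A')} (hJ : J ≤ q) :
    (q.map (Ideal.Quotient.mk J)).under A =
      q.comap (Algebra.TensorProduct.includeLeftRingHom : A →+* A ⊗[k] A') := by
  have : algebraMap A ((A ⊗[k] A') ⧸ J) = (Ideal.Quotient.mk J).comp
    (Algebra.TensorProduct.includeLeftRingHom : A →+* A ⊗[k] A') := rfl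
  rw [Ideal.under_def, this, ← Ideal.comap_comap, Ideal.comap_map_quotientMk, sup_eq_right.2 hJ]

theorem map_mk_mem_minimalPrimes_tensorProduct
    (hq : q ∈ (I.map (Algebra.TensorProduct.includeLeftRingHom : A →+* A ⊗[k] A') ⊔
      I'.map (Algebra.TensorProduct.includeRight : A' →ₐ[k] A ⊗[k] A').toRingHom).minimalPrimes) :
    q.map (Ideal.Quotient.mk
      (I'.map (Algebra.TensorProduct.includeRight : A' →ₐ[k] A ⊗[k] A').toRingHom)) ∈
      (I.map (algebraMap A ((A ⊗[k] A') ⧸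
        I'.map (Algebra.TensorProduct.includeRight : A' →ₐ[k] A ⊗[k] A').toRingHom))).minimalPrimes := by
  have h := Ideal.map_mk_mem_minimalPrimes hq
  rwa [Ideal.map_map] at h

theorem comap_includeLeft_mem_minimalPrimes
    (hq : q ∈ (I.map (Algebra.TensorProduct.includeLeftRingHom : A →+* A ⊗[k] A') ⊔
      I'.map (Algebra.TensorProduct.includeRight : A' →ₐ[k] A ⊗[k] A').toRingHom).minimalPrimes) :
    q.comap (Algebra.TensorProduct.includeLeftRingHom : A →+* A ⊗[k] A') ∈ I.minimalPrimes := by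
  have := flat_quotient_map_includeRight (k := k) (A := A) I'
  rw [← comap_map_mk_of_le q (le_sup_right.trans hq.1.2)]
  exact Ideal.under_mem_minimalPrimes_of_flat (map_mk_mem_minimalPrimes_tensorProduct I I' q hq)

theorem comap_includeRight_mem_minimalPrimes
    (hq : q ∈ (I.map (Algebra.TensorProduct.includeLeftRingHom : A →+* A ⊗[k] A') ⊔
      I'.map (Algebra.TensorProduct.includeRight : A' →ₐ[k] A ⊗[k] A').toRingHom).minimalPrimes) :
    q.comap (Algebra.TensorProduct.includeRight : A' →ₐ[k] A ⊗[k] A').toRingHom ∈ I'.minimalPrimes := by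
  let e := Algebra.TensorProduct.comm k A' A
  have h : q.comap e.toRingEquiv ∈
      (I'.map (Algebra.TensorProduct.includeLeftRingHom : A' →+* A' ⊗[k] A) ⊔
      I.map (Algebra.TensorProduct.includeRight : A →ₐ[k] A' ⊗[k] A).toRingHom).minimalPrimes := by
    have h1 := (Ideal.comap_minimalPrimes_eq_of_surjective
      (f := e.toRingEquiv.toRingHom) e.surjective _).ge ⟨q, hq, rfl⟩
    have h2 (J : Ideal (A ⊗[k] A')) : J.comap e.toRingEquiv.toRingHom =
        J.map e.symm.toRingEquiv.toRingHom := (Ideal.map_symm e.toRingEquiv).symm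
    rw [h2 (_ ⊔ _), Ideal.map_sup, Ideal.map_map, Ideal.map_map, sup_comm] at h1
    exact h1
  exact comap_includeLeft_mem_minimalPrimes I' I _ h

/-- The height of a minimal prime over `I ⊗ A' + A ⊗ I'`. -/
theorem height_of_mem_minimalPrimes_tensorProduct [IsNoetherianRing A] [IsNoetherianRing A']
    [IsNoetherianRing (A ⊗[k] A')]
    (hq : q ∈ (I.map (Algebra.TensorProduct.includeLeftRingHom : A →+* A ⊗[k] A') ⊔
      I'.map (Algebra.TensorProduct.includeRight : A' →ₐ[k] A ⊗[k] A').toRingHom).minimalPrimes) :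
    q.height = (q.comap (Algebra.TensorProduct.includeLeftRingHom : A →+* A ⊗[k] A')).height +
      (q.comap (Algebra.TensorProduct.includeRight : A' →ₐ[k] A ⊗[k] A').toRingHom).height := by
  have := hq.1.1
  let p' := q.comap (Algebra.TensorProduct.includeRight : A' →ₐ[k] A ⊗[k] A').toRingHom
  have hp'q : p'.map (Algebra.TensorProduct.includeRight : A' →ₐ[k] A ⊗[k] A').toRingHom ≤ q :=
    Ideal.map_comap_le
  -- Enlarging `I'` to the contraction `p'` keeps `q` minimal. The fibre term in `h1` then lives in
  -- `A ⊗[k] (A' ⧸ p')`, flat over `A`, where it is the height of the contraction to `A`.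
  have hq' : q ∈ (I.map (Algebra.TensorProduct.includeLeftRingHom : A →+* A ⊗[k] A') ⊔
      p'.map (Algebra.TensorProduct.includeRight : A' →ₐ[k] A ⊗[k] A').toRingHom).minimalPrimes :=
    ⟨⟨‹_›, sup_le (le_sup_left.trans hq.1.2) hp'q⟩, fun r hr hrq => hq.2 ⟨hr.1,
      (sup_le_sup le_rfl (Ideal.map_mono
        (Ideal.map_le_iff_le_comap.1 (le_sup_right.trans hq.1.2)))).trans hr.2⟩ hrq⟩
  have h1 : q.height = p'.height + (q.map (Ideal.Quotient.mk
      (p'.map (Algebra.TensorProduct.includeRight : A' →ₐ[k] A ⊗[k] A').toRingHom))).height := by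
    let := Algebra.TensorProduct.rightAlgebra (R := k) (A := A) (B := A')
    have : Module.Flat A' (A ⊗[k] A') := .of_linearEquiv
      (Algebra.TensorProduct.commRight k A' A).symm.toLinearEquiv
    have : q.LiesOver p' := ⟨rfl⟩
    have : p'.IsPrime := inferInstanceAs (q.under A').IsPrime
    exact Ideal.height_eq_height_add_of_liesOver_of_hasGoingDown p' q
  have := flat_quotient_map_includeRight (k := k) (A := A) p'
  rw [h1, Ideal.height_eq_of_mem_minimalPrimes_of_flat
    (map_mk_mem_minimalPrimes_tensorProduct I p' q hq'), comap_map_mk_of_le q hp'q, add_comm]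

end TensorProduct

end CommutativeAlgebra

/-! ### Smooth schemes over a field -/

namespace AlgebraicGeometry

section SmoothOverField

variable {k : Type u} [Field k] {X : Scheme.{u}}

theorem isDomain_stalk_of_smooth (s : X ⟶ Spec (.of k)) [Smooth s] (x : X) :
    IsDomain (X.presheaf.stalk x) := by
  obtain ⟨R, f, hf, ⟨y, rfl⟩, -⟩ := Scheme.exists_affine_mem_range_and_range_subset
    (show x ∈ (⊤ : X.Opens) from trivial)
  obtain ⟨φ, hφ⟩ := Spec.map_surjective (f ≫ s)
  have h : Smooth (Spec.map φ) := hφ ▸ inferInstance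
  rw [HasRingHomProperty.Spec_iff (P := @Smooth)] at h
  algebraize [φ.hom]
  have : y.asIdeal.IsPrime := PrimeSpectrum.isPrime y
  have := Algebra.Smooth.isDomain_localization (k := k) y.asIdeal
  let : Algebra R ((Spec R).presheaf.stalk y) := StructureSheaf.stalkAlgebra R y
  have : IsLocalization.AtPrime ((Spec R).presheaf.stalk y) y.asIdeal :=
    StructureSheaf.IsLocalization.to_stalk R y
  have : IsDomain ((Spec R).presheaf.stalk y) :=
    (IsLocalization.algEquiv y.asIdeal.primeCompl ((Spec R).presheaf.stalk y)
      (Localization.AtPrime y.asIdeal)).toMulEquiv.isDomain _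
  exact (asIso (f.stalkMap y)).commRingCatIsoToRingEquiv.toMulEquiv.isDomain _

theorem isReduced_of_smooth (s : X ⟶ Spec (.of k)) [Smooth s] : IsReduced X :=
  have (x : X) : _root_.IsReduced (X.presheaf.stalk x) :=
    have := isDomain_stalk_of_smooth s x
    inferInstance
  isReduced_of_isReduced_stalk X

/-- Distinct irreducible components of a closed subscheme smooth over a field are disjoint. -/
theorem eq_of_mem_components_support (s : X ⟶ Spec (.of k)) (I : X.IdealSheafData)
    [Smooth (I.subschemeι ≫ s)] {T₁ T₂ : IrreducibleCloseds X} (h₁ : T₁ ∈ components I.support)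
    (h₂ : T₂ ∈ components I.support) {x : X} (hx₁ : x ∈ T₁) (hx₂ : x ∈ T₂) : T₁ = T₂ := by
  obtain ⟨y, rfl⟩ : x ∈ Set.range I.subschemeι := by
    rw [I.range_subschemeι]
    exact h₁.1 hx₁
  have := isDomain_stalk_of_smooth (I.subschemeι ≫ s) y
  let g := I.subscheme.fromSpecStalk y ≫ I.subschemeι
  have hg : IsIrreducible (Set.range g) := by
    rw [← Set.image_univ]
    exact (IrreducibleSpace.isIrreducible_univ _).image _ g.continuous.continuousOn
  -- The spectrum of the local ring at `y` is irreducible and contains the generic point of every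
  -- component through `y`; by maximality each such component is the closure `V` of its image.
  let V : IrreducibleCloseds X := ⟨closure (Set.range g), hg.closure, isClosed_closure⟩
  have hV : (V : Set X) ⊆ I.support := by
    refine closure_minimal ?_ I.support.isClosed
    rintro _ ⟨z, rfl⟩
    rw [← I.range_subschemeι]
    exact ⟨I.subscheme.fromSpecStalk y z, by simp [g]⟩
  have key (T : IrreducibleCloseds X) (hT : T ∈ components I.support) (hx : I.subschemeι y ∈ T) :
      T = V := by
    refine le_antisymm ?_ (hT.2 hV ?_) <;>
    · obtain ⟨ξ, hξ⟩ := QuasiSober.sober T.isIrreducible T.isClosed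
      obtain ⟨η, rfl⟩ : ξ ∈ Set.range I.subschemeι := by
        rw [I.range_subschemeι]
        exact hT.1 hξ.mem
      have hη : η ⤳ y := I.subschemeι.isEmbedding.isInducing.specializes_iff.1 (hξ.specializes hx)
      have hη' : η ∈ Set.range (I.subscheme.fromSpecStalk y) := by
        rw [Scheme.range_fromSpecStalk]
        exact hη
      obtain ⟨z, rfl⟩ := hη'
      intro t ht
      exact (hξ.specializes ht).mem_closed isClosed_closure (subset_closure ⟨z, by simp [g]⟩)
  rw [key T₁ h₁ hx₁, key T₂ h₂ hx₂]

end SmoothOverField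

/-! ### Ideal sheaves of closed subsets -/

section IdealSheaf

variable {X Y S : Scheme.{u}}

/-- The vanishing ideal of the support is the radical of `I`, and reducedness of the subscheme says
that `I` is radical. -/
theorem vanishingIdeal_support_of_isReduced (I : X.IdealSheafData) [IsReduced I.subscheme] :
    Scheme.IdealSheafData.vanishingIdeal I.support = I := by
  rw [Scheme.IdealSheafData.vanishingIdeal_support]
  refine le_antisymm (fun U x hx => ?_) I.le_radical
  obtain ⟨n, hn⟩ : ∃ n : ℕ, x ^ n ∈ I.ideal U := hx
  rw [← I.ker_subschemeι_app, RingHom.mem_ker] at hn ⊢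
  rw [map_pow] at hn
  exact eq_zero_of_pow_eq_zero hn

/-- Since `V(I)` lies in `O`, it coincides with `V(J) ∩ O`, an open subscheme of `V(J)`. -/
theorem smooth_subscheme_of_comap_eq (s : X ⟶ S) (O : X.Opens) (I J : X.IdealSheafData)
    (hsupp : (I.support : Set X) ⊆ O) (hcomap : I.comap O.ι = J.comap O.ι)
    [Smooth (J.subschemeι ≫ s)] : Smooth (I.subschemeι ≫ s) := by
  let a := pullback.snd O.ι I.subschemeι
  have ha : Function.Surjective a := by
    intro y
    have hy : I.subschemeι y ∈ Set.range O.ι := by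
      rw [Scheme.Opens.range_ι]
      apply hsupp
      rw [← I.range_subschemeι]
      exact ⟨y, rfl⟩
    obtain ⟨z, hz⟩ := hy
    obtain ⟨w, -, hw⟩ := Scheme.Pullback.exists_preimage_pullback (f := O.ι) (g := I.subschemeι) z y hz
    exact ⟨w, hw⟩
  have : Surjective a := ⟨ha⟩
  have : IsIso a := (isIso_iff_isOpenImmersion_and_surjective a).2 ⟨inferInstance, this⟩
  have h1 : I.subschemeι ≫ s = inv a ≫ (I.comapIso O.ι).inv ≫
      (I.comap O.ι).subschemeι ≫ O.ι ≫ s := by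
    rw [IsIso.eq_inv_comp]
    simp [a, pullback.condition_assoc]
  have h2 : (J.comap O.ι).subschemeι ≫ O.ι ≫ s = (J.comapIso O.ι).hom ≫
      pullback.snd O.ι J.subschemeι ≫ J.subschemeι ≫ s := by
    rw [← pullback.condition_assoc]
    simp
  have h3 : Smooth ((I.comap O.ι).subschemeι ≫ O.ι ≫ s) := by
    rw [hcomap, h2]
    infer_instance
  rw [h1]
  infer_instance

theorem comap_vanishingIdeal_eq_of_inter_eq (O : X.Opens) {D W : Closeds X}
    (h : (D : Set X) ∩ O = (W : Set X) ∩ O) :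
    (Scheme.IdealSheafData.vanishingIdeal D).comap O.ι =
      (Scheme.IdealSheafData.vanishingIdeal W).comap O.ι := by
  ext U : 2
  rw [Scheme.IdealSheafData.ideal_comap_of_isOpenImmersion,
    Scheme.IdealSheafData.ideal_comap_of_isOpenImmersion]
  simp only [Scheme.IdealSheafData.vanishingIdeal_ideal]
  congr 2
  ext z
  have hz : (U.2.image_of_isOpenImmersion O.ι).fromSpec z ∈ O := by
    have h : (U.2.image_of_isOpenImmersion O.ι).fromSpec z ∈ O.ι ''ᵁ U :=
      (U.2.image_of_isOpenImmersion O.ι).range_fromSpec.le ⟨z, rfl⟩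
    exact O.ι_image_le _ h
  have h' := Set.ext_iff.1 h ((U.2.image_of_isOpenImmersion O.ι).fromSpec z)
  exact ⟨fun hD => (h'.1 ⟨hD, hz⟩).1, fun hW => (h'.2 ⟨hW, hz⟩).1⟩

end IdealSheaf

/-! ### Closed subschemes of fibre products -/

section Product

variable {X Y S : Scheme.{u}} (s : X ⟶ S) (t : Y ⟶ S)

/-- The subscheme in question is `V(I) ×_S V(J)`, embedded by `i`; the two are identified by showing
that `i` has kernel `K`. -/
theorem smooth_subscheme_comap_sup_comap (I : X.IdealSheafData) (J : Y.IdealSheafData)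
    [Smooth (I.subschemeι ≫ s)] [Smooth (J.subschemeι ≫ t)] :
    Smooth ((I.comap (pullback.fst s t) ⊔ J.comap (pullback.snd s t)).subschemeι ≫
      pullback.fst s t ≫ s) := by
  let K := I.comap (pullback.fst s t) ⊔ J.comap (pullback.snd s t)
  let i : pullback (I.subschemeι ≫ s) (J.subschemeι ≫ t) ⟶ pullback s t :=
    pullback.lift (pullback.fst _ _ ≫ I.subschemeι) (pullback.snd _ _ ≫ J.subschemeι)
      (by simp [pullback.condition])
  have hfst : i ≫ pullback.fst s t = pullback.fst _ _ ≫ I.subschemeι := pullback.lift_fst _ _ _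
  have hsnd : i ≫ pullback.snd s t = pullback.snd _ _ ≫ J.subschemeι := pullback.lift_snd _ _ _
  have : MorphismProperty.IsStableUnderComposition (@IsClosedImmersion.{u}) :=
    MorphismProperty.IsMultiplicative.toIsStableUnderComposition
  have hi : IsClosedImmersion i :=
    MorphismProperty.pullbackMap (P := @IsClosedImmersion) inferInstance inferInstance rfl rfl
  have hker : i.ker = K := by
    apply le_antisymm
    · let l : K.subscheme ⟶ pullback (I.subschemeι ≫ s) (J.subschemeι ≫ t) := pullback.lift
        (IsClosedImmersion.lift I.subschemeι (K.subschemeι ≫ pullback.fst s t) (by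
          rw [Scheme.IdealSheafData.ker_subschemeι, Scheme.Hom.ker_comp,
            Scheme.IdealSheafData.ker_subschemeι, Scheme.IdealSheafData.le_map_iff_comap_le]
          exact le_sup_left))
        (IsClosedImmersion.lift J.subschemeι (K.subschemeι ≫ pullback.snd s t) (by
          rw [Scheme.IdealSheafData.ker_subschemeι, Scheme.Hom.ker_comp,
            Scheme.IdealSheafData.ker_subschemeι, Scheme.IdealSheafData.le_map_iff_comap_le]
          exact le_sup_right))
        (by simp [pullback.condition])
      have hlfst : l ≫ pullback.fst _ _ = _ := pullback.lift_fst _ _ _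
      have hlsnd : l ≫ pullback.snd _ _ = _ := pullback.lift_snd _ _ _
      have hl : l ≫ i = K.subschemeι := by
        apply pullback.hom_ext
        · rw [Category.assoc, hfst, reassoc_of% hlfst, IsClosedImmersion.lift_fac]
        · rw [Category.assoc, hsnd, reassoc_of% hlsnd, IsClosedImmersion.lift_fac]
      rw [← K.ker_subschemeι, ← hl]
      exact Scheme.Hom.le_ker_comp l i
    · apply sup_le
      · rw [← Scheme.IdealSheafData.le_map_iff_comap_le, Scheme.IdealSheafData.map_ker]
        rw [hfst]
        exact I.ker_subschemeι.ge.trans (Scheme.Hom.le_ker_comp _ _)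
      · rw [← Scheme.IdealSheafData.le_map_iff_comap_le, Scheme.IdealSheafData.map_ker]
        rw [hsnd]
        exact J.ker_subschemeι.ge.trans (Scheme.Hom.le_ker_comp _ _)
  have := IsClosedImmersion.isIso_lift i K.subschemeι (by rw [hker, K.ker_subschemeι])
  have h : K.subschemeι ≫ pullback.fst s t ≫ s = IsClosedImmersion.lift i K.subschemeι
      (by rw [hker, K.ker_subschemeι]) ≫ pullback.fst _ _ ≫ I.subschemeι ≫ s := by
    conv_lhs => rw [← IsClosedImmersion.lift_fac i K.subschemeι (by rw [hker, K.ker_subschemeι])]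
    rw [Category.assoc, reassoc_of% hfst]
  change Smooth (K.subschemeι ≫ pullback.fst s t ≫ s)
  rw [h]
  infer_instance

theorem smooth_subscheme_comap_fst [Smooth t] (I : X.IdealSheafData) [Smooth (I.subschemeι ≫ s)] :
    Smooth ((I.comap (pullback.fst s t)).subschemeι ≫ pullback.fst s t ≫ s) := by
  have := smooth_subscheme_comap_sup_comap s t I ⊥
  rwa [Scheme.IdealSheafData.comap_bot, sup_bot_eq] at this

theorem smooth_subscheme_comap_snd [Smooth s] (J : Y.IdealSheafData) [Smooth (J.subschemeι ≫ t)] :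
    Smooth ((J.comap (pullback.snd s t)).subschemeι ≫ pullback.fst s t ≫ s) := by
  have := smooth_subscheme_comap_sup_comap s t ⊥ J
  rwa [Scheme.IdealSheafData.comap_bot, bot_sup_eq] at this

variable {k : Type u} [Field k] {X Y : Scheme.{u}} (s : X ⟶ Spec (.of k)) (t : Y ⟶ Spec (.of k))

/-- The pulled back subscheme is smooth over `k`, hence reduced, so its ideal is the full vanishing
ideal of its support. -/
theorem comap_fst_vanishingIdeal [Smooth t] (D : Closeds X)
    [Smooth ((Scheme.IdealSheafData.vanishingIdeal D).subschemeι ≫ s)] :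
    (Scheme.IdealSheafData.vanishingIdeal D).comap (pullback.fst s t) =
      Scheme.IdealSheafData.vanishingIdeal
        (preim (pullback.fst s t) (pullback.fst s t).continuous D) := by
  have := smooth_subscheme_comap_fst s t (Scheme.IdealSheafData.vanishingIdeal D)
  have := isReduced_of_smooth (((Scheme.IdealSheafData.vanishingIdeal D).comap
    (pullback.fst s t)).subschemeι ≫ pullback.fst s t ≫ s)
  rw [← vanishingIdeal_support_of_isReduced ((Scheme.IdealSheafData.vanishingIdeal D).comap
    (pullback.fst s t))]
  congr 1
  ext x
  simp [preim]

theorem comap_snd_vanishingIdeal [Smooth s] (D : Closeds Y)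
    [Smooth ((Scheme.IdealSheafData.vanishingIdeal D).subschemeι ≫ t)] :
    (Scheme.IdealSheafData.vanishingIdeal D).comap (pullback.snd s t) =
      Scheme.IdealSheafData.vanishingIdeal
        (preim (pullback.snd s t) (pullback.snd s t).continuous D) := by
  have := smooth_subscheme_comap_snd s t (Scheme.IdealSheafData.vanishingIdeal D)
  have := isReduced_of_smooth (((Scheme.IdealSheafData.vanishingIdeal D).comap
    (pullback.snd s t)).subschemeι ≫ pullback.fst s t ≫ s)
  rw [← vanishingIdeal_support_of_isReduced ((Scheme.IdealSheafData.vanishingIdeal D).comap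
    (pullback.snd s t))]
  congr 1
  ext x
  simp [preim]

end Product

end AlgebraicGeometry

namespace LogPair

/-! ### Components and codimension through generic points -/

section GenericPoints

/-- `x` is the generic point of an irreducible component of `D`. -/
def IsGenericIn {X : Type*} [TopologicalSpace X] (D : Set X) (x : X) : Prop :=
  x ∈ D ∧ ∀ y ∈ D, y ⤳ x → x ⤳ y

/-- Open sets are stable under generization, so genericity can be tested in any open chart. -/
theorem IsGenericIn.of_isOpenEmbedding {X Y : Type*} [TopologicalSpace X] [TopologicalSpace Y]
    {f : X → Y} (hf : Topology.IsOpenEmbedding f) {D : Set Y} {x : X} :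
    IsGenericIn (f ⁻¹' D) x ↔ IsGenericIn D (f x) := by
  refine ⟨fun h => ⟨h.1, fun y hy hyx => ?_⟩, fun h => ⟨h.1, fun y hy hyx => ?_⟩⟩
  · obtain ⟨y, rfl⟩ := hf.isOpen_range.stableUnderGeneralization hyx ⟨x, rfl⟩
    exact (h.2 y hy (hf.isInducing.specializes_iff.1 hyx)).map hf.continuous
  · exact hf.isInducing.specializes_iff.1 (h.2 _ hy (hyx.map hf.continuous))

attribute [local instance] specializationOrder

variable {X : Type*} [TopologicalSpace X] [QuasiSober X] [T0Space X]

theorem mem_components_iff_isGenericIn (D : Closeds X) (T : IrreducibleCloseds X) :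
    T ∈ components D ↔ IsGenericIn (D : Set X) (irreducibleSetEquivPoints T) := by
  obtain ⟨x, rfl⟩ := irreducibleSetEquivPoints.symm.surjective T
  have hle (y : X) : ((irreducibleSetEquivPoints.symm y : IrreducibleCloseds X) : Set X) ⊆ D ↔
      y ∈ D := by
    rw [coe_irreducibleEquivPoints_symm_apply, D.isClosed.closure_subset_iff,
      Set.singleton_subset_iff]
    rfl
  rw [OrderIso.apply_symm_apply]
  constructor
  · refine fun h => ⟨(hle x).1 h.1, fun y hy hyx => ?_⟩
    have := h.2 (y := irreducibleSetEquivPoints.symm y) ((hle y).2 hy)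
      ((irreducibleSetEquivPoints.symm.le_iff_le).2 hyx)
    exact (irreducibleSetEquivPoints.symm.le_iff_le).1 this
  · refine fun h => ⟨(hle x).2 h.1, fun R hR hxR => ?_⟩
    obtain ⟨y, rfl⟩ := irreducibleSetEquivPoints.symm.surjective R
    exact (irreducibleSetEquivPoints.symm.le_iff_le).2
      (h.2 y ((hle y).1 hR) ((irreducibleSetEquivPoints.symm.le_iff_le).1 hxR))

/-- Irreducible closed sets and points form isomorphic orders; at points, codimension is local and
becomes the height of a prime. -/
theorem isOfPureCodim_iff (D : Closeds X) (n : ℕ) :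
    IsOfPureCodim D n ↔ ∀ x, IsGenericIn (D : Set X) x → Order.coheight x = n := by
  constructor
  · intro h x hx
    have h1 := (mem_components_iff_isGenericIn D (irreducibleSetEquivPoints.symm x)).2
      (by rwa [OrderIso.apply_symm_apply])
    rw [← h _ h1, Order.coheight_orderIso]
  · intro h T hT
    rw [← h _ ((mem_components_iff_isGenericIn D T).1 hT), Order.coheight_orderIso]

theorem isGenericIn_zeroLocus_iff {R : Type*} [CommRing R] (I : Ideal R) (x : PrimeSpectrum R) :
    IsGenericIn (PrimeSpectrum.zeroLocus (I : Set R)) x ↔ x.asIdeal ∈ I.minimalPrimes := by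
  simp only [IsGenericIn, ← PrimeSpectrum.le_iff_specializes]
  exact ⟨fun h => ⟨⟨x.2, h.1⟩, fun q hq hqx => h.2 ⟨q, hq.1⟩ hq.2 hqx⟩,
    fun h => ⟨h.1.2, fun y hy hyx => h.2 ⟨y.2, hy⟩ hyx⟩⟩

end GenericPoints

end LogPair

namespace AlgebraicGeometry

/-! ### Additivity of codimension in products -/

section Codimension

open TensorProduct

variable {k : Type u} [Field k] {X Y : Scheme.{u}} (s : X ⟶ Spec (.of k)) (t : Y ⟶ Spec (.of k))

theorem coheight_of_isGenericIn_Spec_tensorProduct {A A' : Type u} [CommRing A] [CommRing A']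
    [Algebra k A] [Algebra k A'] [Algebra.FiniteType k A] [Algebra.FiniteType k A']
    {Z : Set (Spec (.of A))} {Z' : Set (Spec (.of A'))} (hZ : IsClosed Z) (hZ' : IsClosed Z')
    (x : Spec (.of (A ⊗[k] A')))
    (hx : IsGenericIn (Spec.map (CommRingCat.ofHom
        (Algebra.TensorProduct.includeLeftRingHom : A →+* A ⊗[k] A')) ⁻¹' Z ∩
      Spec.map (CommRingCat.ofHom
        (Algebra.TensorProduct.includeRight : A' →ₐ[k] A ⊗[k] A').toRingHom) ⁻¹' Z') x) :
    IsGenericIn Z (Spec.map (CommRingCat.ofHom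
      (Algebra.TensorProduct.includeLeftRingHom : A →+* A ⊗[k] A')) x) ∧
    IsGenericIn Z' (Spec.map (CommRingCat.ofHom
      (Algebra.TensorProduct.includeRight : A' →ₐ[k] A ⊗[k] A').toRingHom) x) ∧
    Order.coheight x = Order.coheight (Spec.map (CommRingCat.ofHom
      (Algebra.TensorProduct.includeLeftRingHom : A →+* A ⊗[k] A')) x) +
      Order.coheight (Spec.map (CommRingCat.ofHom
        (Algebra.TensorProduct.includeRight : A' →ₐ[k] A ⊗[k] A').toRingHom) x) := by
  obtain ⟨I, rfl⟩ := (PrimeSpectrum.isClosed_iff_zeroLocus_ideal (R := A) Z).1 hZ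
  obtain ⟨I', rfl⟩ := (PrimeSpectrum.isClosed_iff_zeroLocus_ideal (R := A') Z').1 hZ'
  have hx' : x.asIdeal ∈ (I.map (Algebra.TensorProduct.includeLeftRingHom : A →+* A ⊗[k] A') ⊔
      I'.map (Algebra.TensorProduct.includeRight :
        A' →ₐ[k] A ⊗[k] A').toRingHom).minimalPrimes := by
    refine (isGenericIn_zeroLocus_iff (R := A ⊗[k] A') _ x).1 ?_
    convert hx using 1
    rw [PrimeSpectrum.zeroLocus_sup, Ideal.map, Ideal.map, PrimeSpectrum.zeroLocus_span,
      PrimeSpectrum.zeroLocus_span, ← PrimeSpectrum.preimage_comap_zeroLocus,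
      ← PrimeSpectrum.preimage_comap_zeroLocus]
    rfl
  have : IsNoetherianRing A := Algebra.FiniteType.isNoetherianRing k A
  have : IsNoetherianRing A' := Algebra.FiniteType.isNoetherianRing k A'
  have : Algebra.FiniteType k (A ⊗[k] A') := .trans (S := A) inferInstance inferInstance
  have : IsNoetherianRing (A ⊗[k] A') := Algebra.FiniteType.isNoetherianRing k _
  refine ⟨(isGenericIn_zeroLocus_iff I _).2 (comap_includeLeft_mem_minimalPrimes I I' _ hx'),
    (isGenericIn_zeroLocus_iff I' _).2 (comap_includeRight_mem_minimalPrimes I I' _ hx'), ?_⟩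
  rw [← idealHeight_eq_coheight, ← idealHeight_eq_coheight, ← idealHeight_eq_coheight]
  exact height_of_mem_minimalPrimes_tensorProduct I I' _ hx'

/-- Genericity and coheight are unchanged by open embeddings, so affine charts reduce this to `Spec
(A ⊗[k] A')`. -/
theorem coheight_of_isGenericIn_prod [LocallyOfFiniteType s] [LocallyOfFiniteType t]
    (Z : Closeds X) (Z' : Closeds Y) (x : (pullback s t : Scheme.{u}))
    (hx : IsGenericIn (pullback.fst s t ⁻¹' (Z : Set X) ∩ pullback.snd s t ⁻¹' (Z' : Set Y)) x) :
    IsGenericIn (Z : Set X) (pullback.fst s t x) ∧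
    IsGenericIn (Z' : Set Y) (pullback.snd s t x) ∧
    Order.coheight x =
      Order.coheight (pullback.fst s t x) + Order.coheight (pullback.snd s t x) := by
  obtain ⟨A, i, hi, ⟨a, ha⟩, -⟩ := Scheme.exists_affine_mem_range_and_range_subset
    (show pullback.fst s t x ∈ (⊤ : X.Opens) from trivial)
  obtain ⟨A', i', hi', ⟨a', ha'⟩, -⟩ := Scheme.exists_affine_mem_range_and_range_subset
    (show pullback.snd s t x ∈ (⊤ : Y.Opens) from trivial)
  obtain ⟨φ, hφ⟩ := Spec.map_surjective (i ≫ s)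
  obtain ⟨ψ, hψ⟩ := Spec.map_surjective (i' ≫ t)
  have h1 : LocallyOfFiniteType (Spec.map φ) := hφ ▸ inferInstance
  have h2 : LocallyOfFiniteType (Spec.map ψ) := hψ ▸ inferInstance
  rw [HasRingHomProperty.Spec_iff (P := @LocallyOfFiniteType)] at h1 h2
  algebraize [φ.hom, ψ.hom]
  let m : pullback (Spec.map φ) (Spec.map ψ) ⟶ pullback s t := pullback.map _ _ _ _ i i' (𝟙 _)
    (by simpa using hφ) (by simpa using hψ)
  have hm : IsOpenImmersion m :=
    MorphismProperty.pullbackMap (P := @IsOpenImmersion) hi hi' hφ hψ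
  obtain ⟨y, hy⟩ : x ∈ Set.range m := by
    rw [Scheme.Pullback.range_map]
    exact ⟨⟨a, ha⟩, ⟨a', ha'⟩⟩
  let j : Spec (.of (A ⊗[k] A')) ⟶ pullback s t := (pullbackSpecIso k A A').inv ≫ m
  have hj1 : j ≫ pullback.fst s t = Spec.map (CommRingCat.ofHom
      (Algebra.TensorProduct.includeLeftRingHom : A →+* A ⊗[k] A')) ≫ i := by
    rw [← pullbackSpecIso_inv_fst k A A', Category.assoc, Category.assoc]
    congr 1
    exact pullback.lift_fst _ _ _
  have hj2 : j ≫ pullback.snd s t = Spec.map (CommRingCat.ofHom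
      (Algebra.TensorProduct.includeRight : A' →ₐ[k] A ⊗[k] A').toRingHom) ≫ i' := by
    refine .trans ?_ (congrArg (· ≫ i') (pullbackSpecIso_inv_snd k A A'))
    rw [Category.assoc, Category.assoc]
    congr 1
    exact pullback.lift_snd _ _ _
  have hjo : IsOpenImmersion j := inferInstance
  obtain ⟨z, rfl⟩ : x ∈ Set.range j :=
    ⟨(pullbackSpecIso k A A').hom y, by simp [j, ← hy, ← Scheme.Hom.comp_apply]⟩
  rw [← IsGenericIn.of_isOpenEmbedding j.isOpenEmbedding] at hx
  have e1 (w) : pullback.fst s t (j w) = i (Spec.map (CommRingCat.ofHom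
      (Algebra.TensorProduct.includeLeftRingHom : A →+* A ⊗[k] A')) w) := by
    rw [← Scheme.Hom.comp_apply, hj1, Scheme.Hom.comp_apply]
  have e2 (w) : pullback.snd s t (j w) = i' (Spec.map (CommRingCat.ofHom
      (Algebra.TensorProduct.includeRight : A' →ₐ[k] A ⊗[k] A').toRingHom) w) := by
    rw [← Scheme.Hom.comp_apply, hj2, Scheme.Hom.comp_apply]
  have key := coheight_of_isGenericIn_Spec_tensorProduct (k := k)
    (Z.isClosed.preimage i.continuous) (Z'.isClosed.preimage i'.continuous) z (by
      convert hx using 1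
      ext w
      simp [e1, e2])
  rw [e1, e2, ← IsGenericIn.of_isOpenEmbedding i.isOpenEmbedding,
    ← IsGenericIn.of_isOpenEmbedding i'.isOpenEmbedding]
  refine ⟨key.1, key.2.1, ?_⟩
  rw [i.isOpenEmbedding.coheight_eq, i'.isOpenEmbedding.coheight_eq, j.isOpenEmbedding.coheight_eq]
  exact key.2.2

theorem isOfPureCodim_prod [LocallyOfFiniteType s] [LocallyOfFiniteType t]
    {Z : Closeds X} {Z' : Closeds Y} {m n : ℕ} (hZ : IsOfPureCodim Z m) (hZ' : IsOfPureCodim Z' n) :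
    IsOfPureCodim (preim (pullback.fst s t) (pullback.fst s t).continuous Z ⊓
      preim (pullback.snd s t) (pullback.snd s t).continuous Z') (m + n) := by
  rw [isOfPureCodim_iff] at *
  intro x hx
  obtain ⟨h1, h2, h3⟩ := coheight_of_isGenericIn_prod s t Z Z' x hx
  rw [h3, hZ _ h1, hZ' _ h2, Nat.cast_add]

end Codimension

end AlgebraicGeometry

namespace LogPair

/-! ### Closed sets with disjoint components -/

section Components

variable {X : Type*} [TopologicalSpace X]

theorem mem_components_of_subset {B W : Closeds X} {T : IrreducibleCloseds X}
    (hT : T ∈ components B) (hTW : (T : Set X) ⊆ W) (hWB : (W : Set X) ⊆ B) : T ∈ components W :=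
  ⟨hTW, fun _ hR hTR => hT.2 (hR.trans hWB) hTR⟩

/-- Distinct irreducible components of `W` are disjoint. -/
def DisjointComponents (W : Closeds X) : Prop :=
  ∀ T₁ ∈ components W, ∀ T₂ ∈ components W, ∀ x, x ∈ T₁ → x ∈ T₂ → T₁ = T₂

theorem DisjointComponents.le_of_mem {W : Closeds X} (hW : DisjointComponents W)
    {T S : IrreducibleCloseds X} (hT : T ∈ components W) (hS : (S : Set X) ⊆ W) {x : X}
    (hxT : x ∈ T) (hxS : x ∈ S) : S ≤ T := by
  obtain ⟨R, hR, hSR⟩ := exists_le_component W S hS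
  rwa [hW T hT R hR x hxT (hSR hxS)]

/-- `W` is a finite union of irreducible closed sets. Those not inside `T` miss `T` by disjointness,
and `O` is the complement of their union. -/
theorem DisjointComponents.exists_opens [NoetherianSpace X] {W : Closeds X}
    (hW : DisjointComponents W) {T : IrreducibleCloseds X} (hT : T ∈ components W) :
    ∃ O : Opens X, (T : Set X) ⊆ O ∧ (W : Set X) ∩ O ⊆ T := by
  obtain ⟨S, hfin, hclosed, hirr, hS⟩ :=
    NoetherianSpace.exists_finite_set_isClosed_irreducible W.isClosed
  have hle (t : Set X) (ht : t ∈ S) : t ⊆ W := hS ▸ Set.subset_sUnion_of_mem ht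
  have hcl : IsClosed (⋃₀ {t ∈ S | ¬ t ⊆ T}) := by
    rw [Set.sUnion_eq_biUnion]
    exact (hfin.subset (Set.sep_subset _ _)).isClosed_biUnion fun t ht => hclosed t ht.1
  refine ⟨⟨_, hcl.isOpen_compl⟩, fun x hx => ?_, fun x hx => ?_⟩
  · rintro ⟨t, ht, hxt⟩
    exact ht.2 (hW.le_of_mem (S := ⟨t, hirr t ht.1, hclosed t ht.1⟩) hT (hle t ht.1) hx hxt)
  · obtain ⟨t, ht, hxt⟩ : x ∈ ⋃₀ S := hS ▸ hx.1
    by_contra h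
    exact hx.2 ⟨t, ⟨ht, fun htT => h (htT hxt)⟩, hxt⟩

end Components

/-! ### Strict normal crossing divisors -/

section SNC

variable {S X : Scheme.{u}} {s : X ⟶ S} {D : Closeds X}

theorem interIdeal_singleton (T : IrreducibleCloseds X) :
    interIdeal {T} = Scheme.IdealSheafData.vanishingIdeal ⟨(T : Set X), T.isClosed⟩ := by
  simp [interIdeal]

theorem IsSNC.smooth_vanishingIdeal (hD : IsSNC s D) {T : IrreducibleCloseds X}
    (hT : T ∈ components D) :
    Smooth ((Scheme.IdealSheafData.vanishingIdeal
      ⟨(T : Set X), T.isClosed⟩).subschemeι ≫ s) := by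
  rw [← interIdeal_singleton]
  exact (hD {T} (Finset.singleton_nonempty T) (by simpa using hT)).1

theorem isOfPureCodim_top (X : Type*) [TopologicalSpace X] :
    IsOfPureCodim (⊤ : Closeds X) 0 := by
  intro T hT
  rw [Nat.cast_zero, Order.coheight_eq_zero]
  exact fun R hTR => hT.2 (fun _ _ => trivial) hTR

/-- The empty family gives all of `X`, smooth of codimension `0`. It must be allowed because on a
product all chosen components may come from one factor. -/
theorem IsSNC.smooth_and_isOfPureCodim [Smooth s] (hD : IsSNC s D)
    (A : Finset (IrreducibleCloseds X)) (hA : ∀ T ∈ A, T ∈ components D) :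
    Smooth ((interIdeal A).subschemeι ≫ s) ∧ IsOfPureCodim (interIdeal A).support A.card := by
  rcases A.eq_empty_or_nonempty with rfl | h
  · have : interIdeal (∅ : Finset (IrreducibleCloseds X)) = ⊥ := by simp [interIdeal]
    rw [this]
    exact ⟨inferInstance, isOfPureCodim_top X⟩
  · exact hD A h hA

end SNC

/-! ### The product divisor -/

section Product

variable {k : Type u} [Field k] {X Y : Scheme.{u}} (s : X ⟶ Spec (.of k)) (t : Y ⟶ Spec (.of k))

/-- The preimage in `X × Y` of an irreducible closed subset of `X` or of `Y`. -/
noncomputable def prodPreim (c : IrreducibleCloseds X ⊕ IrreducibleCloseds Y) :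
    Closeds (pullback s t : Scheme.{u}) :=
  c.elim (fun T : IrreducibleCloseds X => preim (pullback.fst s t) (pullback.fst s t).continuous ⟨(T : Set X), T.isClosed⟩)
    (fun T : IrreducibleCloseds Y => preim (pullback.snd s t) (pullback.snd s t).continuous ⟨(T : Set Y), T.isClosed⟩)

/-- The divisor `D × Y + X × E`. -/
noncomputable def prodSum (D : Closeds X) (E : Closeds Y) : Closeds (pullback s t : Scheme.{u}) :=
  preim (pullback.fst s t) (pullback.fst s t).continuous D ⊔
    preim (pullback.snd s t) (pullback.snd s t).continuous E

variable {s t} {D : Closeds X} {E : Closeds Y}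

theorem prodPreim_subset {c : IrreducibleCloseds X ⊕ IrreducibleCloseds Y}
    (hc : c.elim (· ∈ components D) (· ∈ components E)) :
    (prodPreim s t c : Set (pullback s t : Scheme.{u})) ⊆ prodSum s t D E := by
  rcases c with T | T
  · exact fun x hx => Or.inl (hc.1 hx)
  · exact fun x hx => Or.inr (hc.1 hx)

/-- An irreducible `T` lies over `D` or over `E`, and the closure of its image in that factor lies
in a single component. -/
theorem exists_subset_prodPreim {T : IrreducibleCloseds (pullback s t : Scheme.{u})}
    (hT : T ∈ components (prodSum s t D E)) :
    ∃ c : IrreducibleCloseds X ⊕ IrreducibleCloseds Y,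
      c.elim (· ∈ components D) (· ∈ components E) ∧
      (T : Set (pullback s t : Scheme.{u})) ⊆ prodPreim s t c := by
  rcases isPreirreducible_iff_isClosed_union_isClosed.1 T.isIrreducible.2 _ _
    (preim (pullback.fst s t) (pullback.fst s t).continuous D).isClosed
    (preim (pullback.snd s t) (pullback.snd s t).continuous E).isClosed hT.1 with h | h
  · obtain ⟨R, hR, hle⟩ := exists_le_component D ⟨closure (pullback.fst s t '' T),
      (T.isIrreducible.image _ (pullback.fst s t).continuous.continuousOn).closure,
      isClosed_closure⟩ (closure_minimal (by rintro _ ⟨x, hx, rfl⟩; exact h hx) D.isClosed)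
    exact ⟨.inl R, hR, fun x hx => hle (subset_closure ⟨x, hx, rfl⟩)⟩
  · obtain ⟨R, hR, hle⟩ := exists_le_component E ⟨closure (pullback.snd s t '' T),
      (T.isIrreducible.image _ (pullback.snd s t).continuous.continuousOn).closure,
      isClosed_closure⟩ (closure_minimal (by rintro _ ⟨x, hx, rfl⟩; exact h hx) E.isClosed)
    exact ⟨.inr R, hR, fun x hx => hle (subset_closure ⟨x, hx, rfl⟩)⟩

section

variable [Smooth s] [Smooth t] (hD : IsSNC s D) (hE : IsSNC t E)
include hD hE

theorem disjointComponents_prodPreim {c : IrreducibleCloseds X ⊕ IrreducibleCloseds Y}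
    (hc : c.elim (· ∈ components D) (· ∈ components E)) :
    DisjointComponents (prodPreim s t c) := by
  have h : Smooth ((Scheme.IdealSheafData.vanishingIdeal (prodPreim s t c)).subschemeι ≫
      pullback.fst s t ≫ s) := by
    rcases c with T | T
    · have := hD.smooth_vanishingIdeal hc
      have := smooth_subscheme_comap_fst s t
        (Scheme.IdealSheafData.vanishingIdeal ⟨(T : Set X), T.isClosed⟩)
      rwa [comap_fst_vanishingIdeal] at this
    · have := hE.smooth_vanishingIdeal hc
      have := smooth_subscheme_comap_snd s t
        (Scheme.IdealSheafData.vanishingIdeal ⟨(T : Set Y), T.isClosed⟩)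
      rwa [comap_snd_vanishingIdeal] at this
  have e : (Scheme.IdealSheafData.vanishingIdeal (prodPreim s t c)).support = prodPreim s t c := by
    ext x
    simp
  intro T₁ h₁ T₂ h₂ x hx₁ hx₂
  exact eq_of_mem_components_support (pullback.fst s t ≫ s)
    (Scheme.IdealSheafData.vanishingIdeal (prodPreim s t c)) (by rwa [e]) (by rwa [e]) hx₁ hx₂

/-- Sorting `A` by factor exhibits the intersection as an intersection in `X` times one in `Y`. -/
theorem smooth_and_isOfPureCodim_prodPreim
    (A : Finset (IrreducibleCloseds X ⊕ IrreducibleCloseds Y))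
    (hA : ∀ c ∈ A, c.elim (· ∈ components D) (· ∈ components E)) :
    Smooth ((⨆ c ∈ A, Scheme.IdealSheafData.vanishingIdeal (prodPreim s t c)).subschemeι ≫
      pullback.fst s t ≫ s) ∧
    IsOfPureCodim (⨆ c ∈ A, Scheme.IdealSheafData.vanishingIdeal (prodPreim s t c)).support
      A.card := by
  obtain ⟨h1, h2⟩ := hD.smooth_and_isOfPureCodim A.toLeft fun T hT => hA _ (Finset.mem_toLeft.1 hT)
  obtain ⟨h3, h4⟩ := hE.smooth_and_isOfPureCodim A.toRight
    fun T hT => hA _ (Finset.mem_toRight.1 hT)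
  have e : (⨆ c ∈ A, Scheme.IdealSheafData.vanishingIdeal (prodPreim s t c)) =
      (interIdeal A.toLeft).comap (pullback.fst s t) ⊔
        (interIdeal A.toRight).comap (pullback.snd s t) := by
    have e1 : (interIdeal A.toLeft).comap (pullback.fst s t) =
        ⨆ T ∈ A.toLeft, Scheme.IdealSheafData.vanishingIdeal (prodPreim s t (.inl T)) := by
      rw [interIdeal, (Scheme.IdealSheafData.map_gc (pullback.fst s t)).l_iSup₂]
      refine iSup_congr fun T => iSup_congr fun hT => ?_
      have := hD.smooth_vanishingIdeal (hA _ (Finset.mem_toLeft.1 hT))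
      exact comap_fst_vanishingIdeal s t _
    have e2 : (interIdeal A.toRight).comap (pullback.snd s t) =
        ⨆ T ∈ A.toRight, Scheme.IdealSheafData.vanishingIdeal (prodPreim s t (.inr T)) := by
      rw [interIdeal, (Scheme.IdealSheafData.map_gc (pullback.snd s t)).l_iSup₂]
      refine iSup_congr fun T => iSup_congr fun hT => ?_
      have := hE.smooth_vanishingIdeal (hA _ (Finset.mem_toRight.1 hT))
      exact comap_snd_vanishingIdeal s t _
    rw [e1, e2]
    refine le_antisymm (iSup₂_le fun c hc => ?_) (sup_le (iSup₂_le fun T hT => ?_)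
      (iSup₂_le fun T hT => ?_))
    · rcases c with T | T
      · exact le_sup_of_le_left (le_iSup₂_of_le T (Finset.mem_toLeft.2 hc) le_rfl)
      · exact le_sup_of_le_right (le_iSup₂_of_le T (Finset.mem_toRight.2 hc) le_rfl)
    · exact le_iSup₂_of_le (.inl T) (Finset.mem_toLeft.1 hT) le_rfl
    · exact le_iSup₂_of_le (.inr T) (Finset.mem_toRight.1 hT) le_rfl
  rw [e]
  refine ⟨smooth_subscheme_comap_sup_comap s t _ _, ?_⟩
  rw [← Finset.card_toLeft_add_card_toRight]
  convert isOfPureCodim_prod s t h2 h4 using 1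
  ext x
  simp [preim]

theorem isSNC_prodSum [NoetherianSpace (pullback s t : Scheme.{u})] :
    IsSNC (pullback.fst s t ≫ s) (prodSum s t D E) := by
  classical
  intro A hA hAB
  have hex (T : IrreducibleCloseds (pullback s t : Scheme.{u})) :
      ∃ c : IrreducibleCloseds X ⊕ IrreducibleCloseds Y, T ∈ components (prodSum s t D E) →
        c.elim (· ∈ components D) (· ∈ components E) ∧ T ∈ components (prodPreim s t c) := by
    by_cases hT : T ∈ components (prodSum s t D E)
    · obtain ⟨c, hc, hTc⟩ := exists_subset_prodPreim hT
      exact ⟨c, fun _ => ⟨hc, mem_components_of_subset hT hTc (prodPreim_subset hc)⟩⟩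
    -- A junk value for `c` outside the components.
    · obtain ⟨T, hT⟩ := hA
      exact ⟨(exists_subset_prodPreim (hAB T hT)).choose, fun h => absurd h ‹_›⟩
  choose c hc using hex
  replace hc (T) (hT : T ∈ A) := hc T (hAB T hT)
  have hdis (T) (hT : T ∈ A) := disjointComponents_prodPreim hD hE (hc T hT).1
  obtain ⟨h1, h2⟩ := smooth_and_isOfPureCodim_prodPreim hD hE (A.image c)
    (by simpa using fun T hT => (hc T hT).1)
  have hsupp (x : (pullback s t : Scheme.{u})) : x ∈ (interIdeal A).support ↔ ∀ T ∈ A, x ∈ T := by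
    simp [interIdeal]
  have hsupp' (x : (pullback s t : Scheme.{u})) : x ∈ (⨆ d ∈ A.image c,
      Scheme.IdealSheafData.vanishingIdeal (prodPreim s t d)).support ↔
      ∀ T ∈ A, x ∈ prodPreim s t (c T) := by
    simp
  constructor
  · have hO (T : IrreducibleCloseds (pullback s t : Scheme.{u})) :
        ∃ O : Opens (pullback s t : Scheme.{u}), T ∈ A →
          (T : Set (pullback s t : Scheme.{u})) ⊆ O ∧
          (prodPreim s t (c T) : Set (pullback s t : Scheme.{u})) ∩ O ⊆ T := by
      by_cases hT : T ∈ A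
      · obtain ⟨O, hO⟩ := (hdis T hT).exists_opens (hc T hT).2
        exact ⟨O, fun _ => hO⟩
      · exact ⟨⊤, fun h => absurd h hT⟩
    choose O hO using hO
    have hmem (x : (pullback s t : Scheme.{u})) : x ∈ A.inf O ↔ ∀ T ∈ A, x ∈ O T := by
      rw [← SetLike.mem_coe, Opens.coe_finset_inf]
      simp
    -- On the neighbourhood `A.inf O` of the intersection, each `T` agrees with the whole inverse
    -- image `prodPreim s t (c T)`.
    refine smooth_subscheme_of_comap_eq _ (A.inf O) _ (⨆ d ∈ A.image c,
      Scheme.IdealSheafData.vanishingIdeal (prodPreim s t d))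
      (fun x hx => (hmem x).2 fun T hT => (hO T hT).1 ((hsupp x).1 hx T hT)) ?_
    rw [interIdeal, Finset.iSup_finset_image,
      (Scheme.IdealSheafData.map_gc (Scheme.Opens.ι (A.inf O))).l_iSup₂,
      (Scheme.IdealSheafData.map_gc (Scheme.Opens.ι (A.inf O))).l_iSup₂]
    refine iSup_congr fun T => iSup_congr fun hT => comap_vanishingIdeal_eq_of_inter_eq _ ?_
    ext x
    exact ⟨fun hx => ⟨(hc T hT).2.1 hx.1, hx.2⟩,
      fun hx => ⟨(hO T hT).2 ⟨hx.1, (hmem x).1 hx.2 T hT⟩, hx.2⟩⟩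
  · intro R hR
    obtain ⟨x, hx⟩ := R.isIrreducible.1
    have hxA := (hsupp x).1 (hR.1 hx)
    -- Two members of `A` with the same `c` are components of one inverse image and share `x`, so
    -- they coincide. This uses that the intersection is nonempty.
    have hinj : Set.InjOn c A := fun T hT T' hT' h =>
      hdis T hT T (hc T hT).2 T' (h ▸ (hc T' hT').2) x (hxA T hT) (hxA T' hT')
    rw [← Finset.card_image_of_injOn hinj]
    -- `R` stays maximal in the larger intersection: an irreducible set there containing `R` passes
    -- through `x`, hence lies in every `T`.
    refine h2 R ⟨fun y hy => (hsupp' y).2 fun T hT =>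
      (hc T hT).2.1 ((hsupp y).1 (hR.1 hy) T hT), fun R' hR' hRR' => hR.2 ?_ hRR'⟩
    exact fun y hy => (hsupp y).2 fun T hT => (hdis T hT).le_of_mem (hc T hT).2
      (fun z hz => (hsupp' z).1 (hR' hz) T hT) (hxA T hT) (hRR' hx) hy

end

end Product

end LogPair

/-! ### Products in `Sm_log(k)` -/

namespace SmLog

variable {k : Type u} [Field k] {Q : ObjectProperty (Over (Spec (.of k)))}

section Product

variable (M N : SmLog k Q)

theorem noetherianSpace_prodScheme : NoetherianSpace (prodScheme M.X N.X).left := by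
  have := M.smooth
  have := N.smooth
  have := M.quasiCompact
  have := N.quasiCompact
  have : IsLocallyNoetherian (pullback M.X.hom N.X.hom) :=
    LocallyOfFiniteType.isLocallyNoetherian (pullback.fst M.X.hom N.X.hom ≫ M.X.hom)
  have : CompactSpace (pullback M.X.hom N.X.hom : Scheme.{u}) :=
    QuasiCompact.compactSpace_of_compactSpace (pullback.fst M.X.hom N.X.hom ≫ M.X.hom)
  have : IsNoetherian (pullback M.X.hom N.X.hom) := {}
  exact inferInstanceAs (NoetherianSpace (pullback M.X.hom N.X.hom : Scheme.{u}))

theorem isSNC_prodBdry : IsSNC (prodScheme M.X N.X).hom (prodBdry M N) := by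
  have := M.smooth
  have := N.smooth
  have : NoetherianSpace (pullback M.X.hom N.X.hom : Scheme.{u}) := noetherianSpace_prodScheme M N
  exact isSNC_prodSum M.snc N.snc

/-- This inverse image and the product divisor containing it both have pure codimension 1, so its
components are among those of the divisor. -/
theorem isSNC_prodPreim (c : IrreducibleCloseds M.X.left ⊕ IrreducibleCloseds N.X.left)
    (hc : c.elim (· ∈ components M.bdry) (· ∈ components N.bdry)) :
    IsSNC (prodScheme M.X N.X).hom (prodPreim M.X.hom N.X.hom c) := by
  have := M.smooth
  have := N.smooth
  refine (isSNC_prodBdry M N).mono (components_subset (isSNC_prodBdry M N).isOfPureCodim ?_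
    (prodPreim_subset hc))
  have h := (smooth_and_isOfPureCodim_prodPreim M.snc N.snc {c} (by simpa using hc)).2
  have e : (⨆ c' ∈ ({c} : Finset _), Scheme.IdealSheafData.vanishingIdeal
      (prodPreim M.X.hom N.X.hom c')).support = prodPreim M.X.hom N.X.hom c := by
    ext x
    simp
  rw [e, Finset.card_singleton] at h
  exact h

variable {M N} in
theorem isAdmissible_lift {L : SmLog k Q} {f : L.X ⟶ M.X} {g : L.X ⟶ N.X} (hf : IsAdmissible L M f)
    (hg : IsAdmissible L N g) (hmem : Q (prodScheme M.X N.X)) (h : L.X ⟶ prodScheme M.X N.X)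
    (h₁ : h ≫ prodFst M.X N.X = f) (h₂ : h ≫ prodSnd M.X N.X = g) :
    IsAdmissible L (M.tensor N hmem (isSNC_prodBdry M N)) h where
  compl x hx := by
    subst h₁ h₂
    rintro (h | h)
    · exact hf.compl x hx h
    · exact hg.compl x hx h
  snc T hT := by
    have := M.smooth
    have := N.smooth
    subst h₁ h₂
    obtain ⟨c, hc, hTc⟩ := exists_subset_prodPreim (s := M.X.hom) (t := N.X.hom) hT
    have hTc' := mem_components_of_subset hT hTc (prodPreim_subset hc)
    have hdis := disjointComponents_prodPreim M.snc N.snc hc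
    have hsnc : IsSNC L.X.hom (preim h.left h.left.continuous (prodPreim M.X.hom N.X.hom c)) := by
      rcases c with R | R
      · exact hf.snc R hc
      · exact hg.snc R hc
    -- Components of the inverse image of `T` are components of the inverse image of `prodPreim _ _
    -- c`: a larger irreducible `R` has image meeting `T`, and disjointness forces that image into
    -- `T`.
    refine hsnc.mono fun C hC => ⟨fun x hx => hTc (hC.1 hx), fun R hR hCR => hC.2 ?_ hCR⟩
    obtain ⟨x, hx⟩ := C.isIrreducible.1
    let R' : IrreducibleCloseds (prodScheme M.X N.X).left := ⟨closure (h.left '' R),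
      (R.isIrreducible.image _ h.left.continuous.continuousOn).closure, isClosed_closure⟩
    have hR' : R' ≤ T := hdis.le_of_mem hTc'
      (closure_minimal (by rintro _ ⟨y, hy, rfl⟩; exact hR hy) (prodPreim M.X.hom N.X.hom c).isClosed)
      (x := h.left x) (hC.1 hx) (subset_closure ⟨x, hCR hx, rfl⟩)
    exact fun y hy => hR' (subset_closure ⟨y, hy, rfl⟩)

variable (hQ : ∀ X Y : Over (Spec (.of k)), Q X → Q Y → Q (prodScheme X Y))

/-- The product `(X × Y, ∂X × Y + X × ∂Y)`. -/
noncomputable abbrev prod : SmLog k Q := M.tensor N (hQ _ _ M.mem N.mem) (isSNC_prodBdry M N)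

theorem isAdmissible_prodFst : IsAdmissible (prod M N hQ) M (prodFst M.X N.X) where
  snc T hT := isSNC_prodPreim M N (.inl T) hT
  compl _ hx h := hx (.inl h)

theorem isAdmissible_prodSnd : IsAdmissible (prod M N hQ) N (prodSnd M.X N.X) where
  snc T hT := isSNC_prodPreim M N (.inr T) hT
  compl _ hx h := hx (.inr h)

/-- The projection to the first factor. -/
noncomputable def fst : prod M N hQ ⟶ M := ⟨_, isAdmissible_prodFst M N hQ⟩

/-- The projection to the second factor. -/
noncomputable def snd : prod M N hQ ⟶ N := ⟨_, isAdmissible_prodSnd M N hQ⟩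

theorem prodScheme_hom_ext {X Y Z : Over (Spec (.of k))} {f g : Z ⟶ prodScheme X Y}
    (h₁ : f ≫ prodFst X Y = g ≫ prodFst X Y) (h₂ : f ≫ prodSnd X Y = g ≫ prodSnd X Y) : f = g := by
  apply Over.OverMorphism.ext
  apply pullback.hom_ext
  · exact congrArg CommaMorphism.left h₁
  · exact congrArg CommaMorphism.left h₂

/-- The morphism to the product of two `k`-schemes induced by two morphisms. -/
noncomputable def prodSchemeLift {X Y Z : Over (Spec (.of k))} (f : Z ⟶ X) (g : Z ⟶ Y) :
    Z ⟶ prodScheme X Y :=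
  Over.homMk (pullback.lift f.left g.left ((Over.w f).trans (Over.w g).symm))
    ((pullback.lift_fst_assoc _ _ _ _).trans (Over.w f))

theorem prodSchemeLift_fst {X Y Z : Over (Spec (.of k))} (f : Z ⟶ X) (g : Z ⟶ Y) :
    prodSchemeLift f g ≫ prodFst X Y = f :=
  Over.OverMorphism.ext (pullback.lift_fst _ _ _)

theorem prodSchemeLift_snd {X Y Z : Over (Spec (.of k))} (f : Z ⟶ X) (g : Z ⟶ Y) :
    prodSchemeLift f g ≫ prodSnd X Y = g :=
  Over.OverMorphism.ext (pullback.lift_snd _ _ _)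

variable {M N} in
/-- The morphism to the product induced by two morphisms of pairs. -/
noncomputable def lift {L : SmLog k Q} (f : L ⟶ M) (g : L ⟶ N) : L ⟶ prod M N hQ :=
  ⟨prodSchemeLift f.1 g.1, isAdmissible_lift f.2 g.2 _ _ (prodSchemeLift_fst f.1 g.1)
    (prodSchemeLift_snd f.1 g.1)⟩

/-- `(X × Y, ∂X × Y + X × ∂Y)` is the product in `Sm_log(k)`. -/
noncomputable def isLimitProd : IsLimit (BinaryFan.mk (fst M N hQ) (snd M N hQ)) :=
  BinaryFan.IsLimit.mk _ (fun f g => lift hQ f g)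
    (fun f g => Subtype.ext (prodSchemeLift_fst f.1 g.1))
    (fun f g => Subtype.ext (prodSchemeLift_snd f.1 g.1))
    (fun f g _ h h' => Subtype.ext (prodScheme_hom_ext
      ((congrArg Subtype.val h).trans (prodSchemeLift_fst f.1 g.1).symm)
      ((congrArg Subtype.val h').trans (prodSchemeLift_snd f.1 g.1).symm)))

end Product

end SmLog

/-! ### Localizations preserving binary products -/

namespace CategoryTheory.Localization

variable {C : Type*} [Category* C] (W : MorphismProperty C)

/-- The morphisms of `C` which become isomorphisms in the localization at `W`. -/
abbrev saturation : MorphismProperty C := (MorphismProperty.isomorphisms _).inverseImage W.Q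

theorem le_saturation : W ≤ saturation W := fun _ _ f hf => W.Q_inverts f hf

/-- The localization at `W` is also the localization at the saturation of `W`. -/
noncomputable def strictUniversalPropertyFixedTargetSaturation (E : Type*) [Category* E] :
    StrictUniversalPropertyFixedTarget W.Q (saturation W) E where
  inverts _ _ _ hf := hf
  lift F hF := Construction.lift F fun _ _ f hf => hF f (le_saturation W f hf)
  fac F _ := Construction.fac F _
  uniq := Construction.uniq

instance : W.Q.IsLocalization (saturation W) :=
  .mk' _ _ (strictUniversalPropertyFixedTargetSaturation W _)
    (strictUniversalPropertyFixedTargetSaturation W _)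

/-- `F` factors through `W.Q`, so it inverts everything that `W.Q` inverts. -/
theorem saturation_map {D : Type*} [Category* D] (F : C ⥤ D) (hF : W.IsInvertedBy F) {X Y : C}
    {f : X ⟶ Y} (hf : saturation W f) : IsIso (F.map f) := by
  have : IsIso (W.Q.map f) := hf
  rw [← Construction.fac F hF]
  exact inferInstanceAs (IsIso ((Construction.lift F hF).map (W.Q.map f)))

/-- If `f × Z` is inverted by the localization at `W` for every `f` in `W` and every object `Z`,
then the localization functor preserves binary products. -/
theorem preservesBinaryProducts_Q [HasBinaryProducts C]
    (h : ∀ ⦃X Y : C⦄ (f : X ⟶ Y) (Z : C), W f → IsIso (W.Q.map (prod.map f (𝟙 Z)))) :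
    PreservesLimitsOfShape (Discrete WalkingPair) W.Q := by
  -- The functor `- × Z` followed by `W.Q` inverts `W`, hence also its saturation.
  have h₁ {X Y : C} (f : X ⟶ Y) (Z : C) (hf : saturation W f) :
      saturation W (prod.map f (𝟙 Z)) :=
    saturation_map W (prod.functor.flip.obj Z ⋙ W.Q) (fun _ _ g hg => h g Z hg) hf
  have h₂ {X Y : C} (f : X ⟶ Y) (Z : C) (hf : saturation W f) :
      saturation W (prod.map (𝟙 Z) f) := by
    have e : prod.map (𝟙 Z) f = (prod.braiding Z X).hom ≫ prod.map f (𝟙 Z) ≫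
        (prod.braiding Y Z).hom := by
      apply Limits.prod.hom_ext
      · rw [Category.assoc, Category.assoc, prod.braiding_hom, prod.braiding_hom, prod.lift_fst,
          prod.map_snd, prod.map_fst, Category.comp_id, Category.comp_id, prod.lift_snd]
      · rw [Category.assoc, Category.assoc, prod.braiding_hom, prod.braiding_hom, prod.lift_snd,
          prod.map_snd, prod.map_fst, ← Category.assoc, prod.lift_fst]
    rw [e, MorphismProperty.cancel_left_of_respectsIso (saturation W),
      MorphismProperty.cancel_right_of_respectsIso (saturation W)]
    exact h₁ f Z hf
  have : (saturation W).IsStableUnderProductsOfShape WalkingPair := by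
    refine ⟨fun X₁ X₂ c₁ c₂ hc₁ hc₂ f hf α hα => ?_⟩
    let e₁ := hc₁.conePointsIsoOfNatIso
      (limit.isLimit (pair (X₁.obj ⟨.left⟩) (X₁.obj ⟨.right⟩))) (diagramIsoPair X₁)
    let e₂ := hc₂.conePointsIsoOfNatIso
      (limit.isLimit (pair (X₂.obj ⟨.left⟩) (X₂.obj ⟨.right⟩))) (diagramIsoPair X₂)
    -- Up to isomorphism a product of two maps is `f × 1` followed by `1 × g`; the saturation is
    -- closed under composition and isomorphism.
    have e : α = e₁.hom ≫ (prod.map (f.app ⟨.left⟩) (𝟙 _) ≫ prod.map (𝟙 _) (f.app ⟨.right⟩)) ≫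
        e₂.inv := by
      rw [← Category.assoc, Iso.eq_comp_inv]
      have h₁₁ : e₁.hom ≫ prod.fst = c₁.π.app ⟨.left⟩ := by
        refine (IsLimit.conePointsIsoOfNatIso_hom_comp _ _ _ (Discrete.mk WalkingPair.left)).trans ?_
        exact Category.comp_id _
      have h₁₂ : e₁.hom ≫ prod.snd = c₁.π.app ⟨.right⟩ := by
        refine (IsLimit.conePointsIsoOfNatIso_hom_comp _ _ _ (Discrete.mk WalkingPair.right)).trans ?_
        exact Category.comp_id _
      have h₂₁ : e₂.hom ≫ prod.fst = c₂.π.app ⟨.left⟩ := by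
        refine (IsLimit.conePointsIsoOfNatIso_hom_comp _ _ _ (Discrete.mk WalkingPair.left)).trans ?_
        exact Category.comp_id _
      have h₂₂ : e₂.hom ≫ prod.snd = c₂.π.app ⟨.right⟩ := by
        refine (IsLimit.conePointsIsoOfNatIso_hom_comp _ _ _ (Discrete.mk WalkingPair.right)).trans ?_
        exact Category.comp_id _
      apply Limits.prod.hom_ext
      · simp only [Category.assoc, h₂₁, prod.map_fst, Category.comp_id, reassoc_of% h₁₁]
        exact hα ⟨.left⟩
      · simp only [Category.assoc, h₂₂, prod.map_snd, Category.id_comp, prod.map_snd_assoc,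
          reassoc_of% h₁₂]
        exact hα ⟨.right⟩
    rw [e, MorphismProperty.cancel_left_of_respectsIso (saturation W),
      MorphismProperty.cancel_right_of_respectsIso (saturation W)]
    exact (saturation W).comp_mem _ _ (h₁ _ _ (hf ⟨.left⟩)) (h₂ _ _ (hf ⟨.right⟩))
  exact preservesProductsOfShape W.Q (saturation W) WalkingPair

end CategoryTheory.Localization

/-! ### Base change of projective and birational morphisms -/

namespace LogPair

theorem ProjectiveSpace.isPullback (n : ℕ) {X Y : Scheme.{u}} (f : X ⟶ Y) :
    ∃ q : ProjectiveSpace n X ⟶ ProjectiveSpace n Y,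
      IsPullback q (ProjectiveSpace.toBase n X) (ProjectiveSpace.toBase n Y) f := by
  let q : ProjectiveSpace n X ⟶ ProjectiveSpace n Y :=
    pullback.lift (pullback.fst _ _ ≫ f) (pullback.snd _ _) (Subsingleton.elim _ _)
  have hq : q ≫ pullback.snd _ _ = pullback.snd _ _ := pullback.lift_snd _ _ _
  have hq' : q ≫ ProjectiveSpace.toBase n Y = ProjectiveSpace.toBase n X ≫ f :=
    pullback.lift_fst _ _ _
  refine ⟨q, IsPullback.of_right ?_ hq' (IsPullback.of_hasPullback _ _).flip⟩
  rw [hq, Subsingleton.elim (f ≫ terminal.from Y) (terminal.from X)]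
  exact (IsPullback.of_hasPullback _ _).flip

variable {X X' P P' : Scheme.{u}} {h : P' ⟶ P} {p' : P' ⟶ X'} {p : P ⟶ X} {π : X' ⟶ X}

theorem IsProjectiveMorphism.of_isPullback (sq : IsPullback p' h π p)
    (hπ : IsProjectiveMorphism π) : IsProjectiveMorphism h := by
  obtain ⟨n, i, hi, rfl⟩ := hπ
  obtain ⟨q, hq⟩ := ProjectiveSpace.isPullback n p
  let j : P' ⟶ ProjectiveSpace n P := hq.lift (p' ≫ i) h (by rw [Category.assoc]; exact sq.w)
  have hj : j ≫ q = p' ≫ i := hq.lift_fst _ _ _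
  have hj' : j ≫ ProjectiveSpace.toBase n P = h := hq.lift_snd _ _ _
  have : IsPullback p' j i q := by
    refine IsPullback.of_bot (h₃₁ := p) (v₂₁ := ProjectiveSpace.toBase n P) ?_ hj.symm hq
    rw [hj']
    exact sq
  exact ⟨n, j, MorphismProperty.of_isPullback this hi, hj'⟩

theorem isIso_morphismRestrict_of_isPullback (sq : IsPullback p' h π p) {U : X.Opens}
    (hU : IsIso (π ∣_ U)) {V : P.Opens} (hVU : V ≤ p ⁻¹ᵁ U) : IsIso (h ∣_ V) := by
  let g : V.toScheme ⟶ U.toScheme := IsOpenImmersion.lift U.ι (V.ι ≫ p) (by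
    rintro _ ⟨x, rfl⟩
    rw [Scheme.Opens.range_ι]
    exact hVU x.2)
  have hg : g ≫ U.ι = V.ι ≫ p := IsOpenImmersion.lift_fac _ _ _
  have h₁ : IsPullback ((h ⁻¹ᵁ V).ι ≫ p') (h ∣_ V) π (g ≫ U.ι) := by
    rw [hg]
    exact (isPullback_morphismRestrict h V).flip.paste_horiz sq
  have h₂ := (isPullback_morphismRestrict π U).flip
  have h₃ := IsPullback.of_right (h₁₁ := h₂.lift _ _ (h₁.w.trans (Category.assoc _ _ _).symm)) (by
    rw [h₂.lift_fst]; exact h₁) (h₂.lift_snd _ _ _) h₂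
  exact MorphismProperty.of_isPullback (P := MorphismProperty.isomorphisms _) h₃ hU

/-- Openness of `p` and `p'` is what keeps inverse images of the two dense sets dense. -/
theorem IsBirationalMorphism.of_isPullback (sq : IsPullback p' h π p) (hp : IsOpenMap p)
    (hp' : IsOpenMap p') (hπ : IsBirationalMorphism π) : IsBirationalMorphism h := by
  obtain ⟨U, hU, hU', hiso⟩ := hπ
  refine ⟨p ⁻¹ᵁ U, hU.preimage hp, ?_, isIso_morphismRestrict_of_isPullback sq hiso le_rfl⟩
  rw [← Scheme.Hom.comp_preimage, ← sq.w, Scheme.Hom.comp_preimage]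
  exact hU'.preimage hp'

end LogPair

/-! ### Stability of admissible blow-ups under products -/

namespace SmLog

variable {k : Type u} [Field k] {Q : ObjectProperty (Over (Spec (.of k)))}
  (hQ : ∀ X Y : Over (Spec (.of k)), Q X → Q Y → Q (prodScheme X Y))

/-- The product of a morphism of pairs with a fixed pair. -/
noncomputable def prodRight {M' M : SmLog k Q} (π : M' ⟶ M) (N : SmLog k Q) :
    prod M' N hQ ⟶ prod M N hQ :=
  lift hQ (fst M' N hQ ≫ π) (snd M' N hQ)

theorem prodRight_fst {M' M : SmLog k Q} (π : M' ⟶ M) (N : SmLog k Q) :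
    prodRight hQ π N ≫ fst M N hQ = fst M' N hQ ≫ π :=
  Subtype.ext (prodSchemeLift_fst _ _)

theorem prodRight_snd {M' M : SmLog k Q} (π : M' ⟶ M) (N : SmLog k Q) :
    prodRight hQ π N ≫ snd M N hQ = snd M' N hQ :=
  Subtype.ext (prodSchemeLift_snd _ _)

/-- Pasting with the square defining `M × N` gives the square defining `M' × N`. -/
theorem isPullback_prodRight {M' M : SmLog k Q} (π : M' ⟶ M) (N : SmLog k Q) :
    IsPullback (pullback.fst M'.X.hom N.X.hom) (prodRight hQ π N).1.left π.1.left
      (pullback.fst M.X.hom N.X.hom) := by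
  have key (r : pullback M'.X.hom N.X.hom ⟶ pullback M.X.hom N.X.hom)
      (h₁ : r ≫ pullback.fst M.X.hom N.X.hom = pullback.fst M'.X.hom N.X.hom ≫ π.1.left)
      (h₂ : r ≫ pullback.snd M.X.hom N.X.hom = pullback.snd M'.X.hom N.X.hom) :
      IsPullback (pullback.fst M'.X.hom N.X.hom) r π.1.left (pullback.fst M.X.hom N.X.hom) := by
    refine IsPullback.of_bot (v₂₁ := pullback.snd M.X.hom N.X.hom) (h₃₁ := N.X.hom)
      (v₂₂ := M.X.hom) ?_ h₁.symm (IsPullback.of_hasPullback M.X.hom N.X.hom)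
    rw [h₂, Over.w π.1]
    exact IsPullback.of_hasPullback M'.X.hom N.X.hom
  exact key _ (pullback.lift_fst _ _ _) (pullback.lift_snd _ _ _)

theorem admissibleBlowups_prodRight {M' M : SmLog k Q} {π : M' ⟶ M} (hπ : admissibleBlowups k Q π)
    (N : SmLog k Q) : admissibleBlowups k Q (prodRight hQ π N) := by
  obtain ⟨h₁, h₂, h₃, h₄⟩ := hπ
  have := N.smooth
  have sq := isPullback_prodRight hQ π N
  refine ⟨h₁.of_isPullback sq, h₂.of_isPullback sq (pullback.fst M.X.hom N.X.hom).isOpenMap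
    (pullback.fst M'.X.hom N.X.hom).isOpenMap, isIso_morphismRestrict_of_isPullback sq h₃ ?_, ?_⟩
  -- The complement of the product boundary lies over the complement of `M.bdry`, where `π` is an
  -- isomorphism.
  · exact fun x hx hx' => hx (.inl hx')
  · ext x
    have e₁ : pullback.fst M.X.hom N.X.hom ((prodRight hQ π N).1.left x) =
        π.1.left (pullback.fst M'.X.hom N.X.hom x) :=
      congrArg (fun f : pullback M'.X.hom N.X.hom ⟶ M.X.left => f x) sq.w.symm
    have e₂ : pullback.snd M.X.hom N.X.hom ((prodRight hQ π N).1.left x) =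
        pullback.snd M'.X.hom N.X.hom x :=
      congrArg (fun f : prodScheme M'.X N.X ⟶ N.X => f.left x)
        (congrArg Subtype.val (prodRight_snd hQ π N))
    change pullback.fst M'.X.hom N.X.hom x ∈ (M'.bdry : Set M'.X.left) ∨
      pullback.snd M'.X.hom N.X.hom x ∈ N.bdry ↔
      pullback.fst M.X.hom N.X.hom ((prodRight hQ π N).1.left x) ∈ M.bdry ∨
      pullback.snd M.X.hom N.X.hom ((prodRight hQ π N).1.left x) ∈ N.bdry
    rw [e₁, e₂, h₄]
    rfl

include hQ in
theorem hasBinaryProducts : HasBinaryProducts (SmLog k Q) := by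
  have (M N : SmLog k Q) : HasLimit (pair M N) := ⟨_, isLimitProd M N hQ⟩
  exact hasBinaryProducts_of_hasLimit_pair _

include hQ in
theorem preservesBinaryProducts_v :
    PreservesLimitsOfShape (Discrete WalkingPair) (BSmLog.v k Q) := by
  have := hasBinaryProducts hQ
  refine Localization.preservesBinaryProducts_Q _ fun M' M π N hπ => ?_
  let e' : prod M' N hQ ≅ M' ⨯ N := (isLimitProd M' N hQ).conePointUniqueUpToIso (limit.isLimit _)
  let e : prod M N hQ ≅ M ⨯ N := (isLimitProd M N hQ).conePointUniqueUpToIso (limit.isLimit _)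
  have h₁' : e'.hom ≫ prod.fst = fst M' N hQ :=
    IsLimit.conePointUniqueUpToIso_hom_comp _ _ (Discrete.mk WalkingPair.left)
  have h₂' : e'.hom ≫ prod.snd = snd M' N hQ :=
    IsLimit.conePointUniqueUpToIso_hom_comp _ _ (Discrete.mk WalkingPair.right)
  have h₁ : e.hom ≫ prod.fst = fst M N hQ :=
    IsLimit.conePointUniqueUpToIso_hom_comp _ _ (Discrete.mk WalkingPair.left)
  have h₂ : e.hom ≫ prod.snd = snd M N hQ :=
    IsLimit.conePointUniqueUpToIso_hom_comp _ _ (Discrete.mk WalkingPair.right)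
  have comm : e'.hom ≫ prod.map π (𝟙 N) = prodRight hQ π N ≫ e.hom := by
    apply Limits.prod.hom_ext
    · rw [Category.assoc, Category.assoc, h₁, prodRight_fst, prod.map_fst, ← Category.assoc, h₁']
    · rw [Category.assoc, Category.assoc, h₂, prodRight_snd, prod.map_snd, Category.comp_id, h₂']
  have hiso : IsIso ((BSmLog.v k Q).map (prodRight hQ π N)) :=
    (admissibleBlowups k Q).Q_inverts _ (admissibleBlowups_prodRight hQ hπ N)
  rw [(Iso.eq_inv_comp e').2 comm, Functor.map_comp, Functor.map_comp]
  infer_instance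

end SmLog

theorem mainTheorem10 (k : Type u) [Field k] (Q : ObjectProperty (Over (Spec (.of k))))
    (hQ : ∀ X Y : Over (Spec (.of k)), Q X → Q Y → Q (SmLog.prodScheme X Y))
    (M N : SmLog k Q) :
    ∃ (hsnc : IsSNC (SmLog.prodScheme M.X N.X).hom (SmLog.prodBdry M N))
      (h₁ : SmLog.IsAdmissible (M.tensor N (hQ _ _ M.mem N.mem) hsnc) M (SmLog.prodFst M.X N.X))
      (h₂ : SmLog.IsAdmissible (M.tensor N (hQ _ _ M.mem N.mem) hsnc) N (SmLog.prodSnd M.X N.X)),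
      Nonempty (IsLimit (BinaryFan.mk
        (P := (BSmLog.v k Q).obj (M.tensor N (hQ _ _ M.mem N.mem) hsnc))
        ((BSmLog.v k Q).map (X := M.tensor N (hQ _ _ M.mem N.mem) hsnc) (Y := M) ⟨_, h₁⟩)
        ((BSmLog.v k Q).map (X := M.tensor N (hQ _ _ M.mem N.mem) hsnc) (Y := N) ⟨_, h₂⟩))) := by
  have := SmLog.preservesBinaryProducts_v hQ
  exact ⟨SmLog.isSNC_prodBdry M N, SmLog.isAdmissible_prodFst M N hQ,
    SmLog.isAdmissible_prodSnd M N hQ,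
    ⟨mapIsLimitOfPreservesOfIsLimit (BSmLog.v k Q) _ _ (SmLog.isLimitProd M N hQ)⟩⟩
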